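/- Let $\Gamma$ be a countable group acting without inversion by graph automorphisms on a tree $\mathcal T$ with at least two vertices. Here "without inversion" means that no element of $\Gamma$ exchanges the two endpoints of an edge, and the stabilizer of an edge is the subgroup of the elements fixing both of its endpoints. A subgroup $\Sigma$ of a group $H$ is called highly core-free in $H$ if for every finite subset $F\subset H$ there exists $g\in H$ such that $gF\cap\Sigma F=\emptyset$ and $\Sigma gu\cap\Sigma gv=\emptyset$ for all $u,v\in F$ with $u\neq v$. Suppose that the stabilizer of every vertex of $\mathcal T$ is infinite and that, for every edge $e$ of $\mathcal T$, the stabilizer of $e$ is finite and is highly core-free in the stabilizer of each of the two endpoints of $e$. Let $\mathcal R$ be the Random Graph, i.e. the unique (up to isomorphism) countable simple graph such that for any two disjoint finite sets $U,W$ of vertices there is a vertex outside $U\cup W$ that is adjacent to every vertex of $U$ and to no vertex of $W$. Then there is an injective group homomorphism $\pi:\Gamma\to\mathrm{Aut}(\mathcal R)$ such that for every graph isomorphism $\varphi:A\to B$ between finite induced subgraphs $A,B$ of $\mathcal R$ there exists $g\in\Gamma$ with $\pi(g)u=\varphi(u)$ for every vertex $u$ of $A$; that is, $\Gamma$ admits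 a faithful homogeneous action on $\mathcal R$. -/

import Mathlib

/-- `R` is a random graph: it has countably many vertices, and for any disjoint finite sets `U`, `W`
of vertices there is a vertex outside `U ∪ W` adjacent to all of `U` and to nothing in `W`.
Such a graph is infinite, and it is unique up to isomorphism. -/
structure IsRandomGraph {V : Type*} (R : SimpleGraph V) : Prop where
  countable : Countable V
  exists_adj : ∀ U W : Finset V, Disjoint U W →
    ∃ z, z ∉ U ∧ z ∉ W ∧ (∀ u ∈ U, R.Adj z u) ∧ ∀ w ∈ W, ¬ R.Adj z w

/-- The graph on `ℕ` in which distinct `m`, `n` are adjacent if and only if the `n`-th binary digit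
of `m` or the `m`-th binary digit of `n` is one. -/
def bitGraph : SimpleGraph ℕ where
  Adj m n := m ≠ n ∧ (m.testBit n = true ∨ n.testBit m = true)
  symm := ⟨fun _ _ h => ⟨h.1.symm, h.2.symm⟩⟩
  loopless := ⟨fun _ h => h.1 rfl⟩

/-- Random graphs exist. -/
theorem isRandomGraph_bitGraph : IsRandomGraph bitGraph := by
  refine ⟨inferInstance, fun U W hUW => ?_⟩
  obtain ⟨m, hm⟩ : ∃ m, ∀ x ∈ U ∪ W, x < m :=
    ⟨(U ∪ W).sup id + 1, fun x hx => Nat.lt_succ_of_le (Finset.le_sup (f := id) hx)⟩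
  let z := Nat.ofBits (n := m + 1) fun i => decide ((i : ℕ) ∈ U ∨ (i : ℕ) = m)
  have hz : ∀ i, i < m + 1 → z.testBit i = decide (i ∈ U ∨ i = m) := fun i hi =>
    Nat.testBit_ofBits_lt _ i hi
  have hmz : m < z := by
    by_contra h
    have h1 := hz m (Nat.lt_succ_self m)
    rw [Nat.testBit_lt_two_pow (lt_of_le_of_lt (not_lt.1 h) Nat.lt_two_pow_self)] at h1
    simp at h1
  have hlt : ∀ x ∈ U ∪ W, x < z := fun x hx => (hm x hx).trans hmz
  refine ⟨z, fun h => (hlt z (Finset.mem_union_left _ h)).false,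
    fun h => (hlt z (Finset.mem_union_right _ h)).false, fun u hu => ?_, fun w hw => ?_⟩
  · have hu' := Finset.mem_union_left W hu
    exact ⟨(hlt u hu').ne', Or.inl (by rw [hz u ((hm u hu').trans (Nat.lt_succ_self m))]; simp [hu])⟩
  · have hw' := Finset.mem_union_right U hw
    rintro ⟨-, h | h⟩
    · rw [hz w ((hm w hw').trans (Nat.lt_succ_self m))] at h
      rcases of_decide_eq_true h with h | h
      · exact Finset.disjoint_left.1 hUW h hw
      · exact (hm w hw').ne h
    · rw [Nat.testBit_lt_two_pow ((hlt w hw').trans Nat.lt_two_pow_self)] at h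
      simp at h

/-- An action of a group on a graph is homogeneous if every isomorphism between finite induced
subgraphs is the restriction of some group element. -/
def IsHomogeneousAction {Γ V : Type*} [Group Γ] {R : SimpleGraph V} (π : Γ →* (R ≃g R)) : Prop :=
  ∀ A B : Set V, A.Finite → B.Finite → ∀ φ : R.induce A ≃g R.induce B,
    ∃ g : Γ, ∀ u : A, π g (u : V) = (φ u : V)

/-- A subgroup `S` of `H` is highly core-free if for every finite `F ⊆ H` there is `g ∈ H` such that
`g F ∩ S F = ∅` and the sets `S g u`, for `u ∈ F`, are pairwise disjoint. -/
def Subgroup.IsHighlyCoreFree {H : Type*} [Group H] (S : Subgroup H) : Prop :=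
  ∀ F : Finset H, ∃ g : H,
    (∀ u ∈ F, ∀ v ∈ F, ∀ s ∈ S, g * u ≠ s * v) ∧
    (∀ u ∈ F, ∀ v ∈ F, u ≠ v → ∀ s ∈ S, ∀ t ∈ S, s * (g * u) ≠ t * (g * v))

/-- The stabilizer of the oriented edge from `x` to `y`: the elements fixing both endpoints. -/
def edgeStabilizer (Γ : Type*) {X : Type*} [Group Γ] [MulAction Γ X] (x y : X) : Subgroup Γ :=
  MulAction.stabilizer Γ x ⊓ MulAction.stabilizer Γ y

/-! The graph is sought on a coset space `Γ ⧸ Λ`, on which `Γ` acts by left multiplication; an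
invariant graph there is a symmetric union `P` of nontrivial double cosets of `Λ`. Both are built
generically from finite approximations (`Approx`): a subgroup `Λ` acting freely on the tree and
cocompactly on a subtree (the core), with finitely many double cosets declared edges (`P`) or
non-edges (`N`). Three kinds of requirements are dense: the extension property (`exists_extension`),
realizing or spoiling a given finite partial isomorphism (`exists_realize`), and faithfulness
(`exists_conj_notMem`). As `Γ` is countable, some directed family of approximations meets them all;
its union is `IsGeneric`, and uniqueness of the random graph transports the action to `R`.

Density rests on room in the tree. Fix an edge from `x₀` to `y₀`. High core-freeness gives `u`, `v`
fixing `x₀` such that prescribed translates of the edges to `u y₀` and `v y₀` leave the core and are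
matched by decided elements only in the unavoidable ways (`exists_isBranching`). Some `k` fixes `y₀`
and moves `x₀`, so `u k v⁻¹` folds everything outside the half-tree at `v y₀` into the half-tree at
`u y₀`.

To send each `s i Λ` to `t i Λ`, the elements `(t i)⁻¹ (v k u⁻¹) s i` are adjoined to `Λ`. Ping-pong
on half-trees shows that the larger group again acts freely and has a core. By `IsGluing.col_eq` no
edge double coset merges with a non-edge one: an equality `σ v = w τ` is peeled letter by letter,
each step exchanging some `(s j)⁻¹ s i` and `(t j)⁻¹ t i`, which have the same colour because the
partial map preserves adjacency. -/

open Pointwise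

/-! ### Half-trees and connected sets in a tree. -/

namespace SimpleGraph

variable {X : Type*} {T : SimpleGraph X} {K K' : Set X} {p q p' q' x y : X}

theorem Reachable.induction_adj {G : SimpleGraph X} {Q : X → Prop} (h : G.Reachable x y)
    (hx : Q x) (hstep : ∀ a b, Q a → G.Adj a b → Q b) : Q y := by
  obtain ⟨w⟩ := h
  induction w with
  | nil => exact hx
  | cons hab _ ih => exact ih (hstep _ _ hx hab)

/-- The vertices on the side of `q` after removing the edge between `p` and `q`. -/
def halfTree (T : SimpleGraph X) (p q : X) : Set X :=
  {x | (T.deleteEdges {s(p, q)}).Reachable q x}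

/-- The edges of `T` with both ends in `K`. -/
def edgesWithin (T : SimpleGraph X) (K : Set X) : SimpleGraph X where
  Adj a b := T.Adj a b ∧ a ∈ K ∧ b ∈ K
  symm := ⟨fun _ _ h => ⟨h.1.symm, h.2.2, h.2.1⟩⟩
  loopless := ⟨fun _ h => h.1.ne rfl⟩

/-- Any two vertices of `K` are joined by a path inside `K`. -/
def ConnectedOn (T : SimpleGraph X) (K : Set X) : Prop :=
  ∀ x ∈ K, ∀ y ∈ K, (T.edgesWithin K).Reachable x y

theorem edgesWithin_mono (h : K ⊆ K') : T.edgesWithin K ≤ T.edgesWithin K' :=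
  fun _ _ hab => ⟨hab.1, h hab.2.1, h hab.2.2⟩

theorem connectedOn_singleton (x : X) : T.ConnectedOn {x} := by
  rintro a rfl b rfl
  exact Reachable.rfl

theorem ConnectedOn.union_of_reachable (hK : T.ConnectedOn K) (hK' : T.ConnectedOn K')
    (hp : p ∈ K) (hq : q ∈ K') (hpq : (T.edgesWithin (K ∪ K')).Reachable p q) :
    T.ConnectedOn (K ∪ K') := by
  have h1 : ∀ x ∈ K ∪ K', (T.edgesWithin (K ∪ K')).Reachable p x := by
    rintro x (hx | hx)
    · exact (hK p hp x hx).mono (edgesWithin_mono Set.subset_union_left)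
    · exact hpq.trans ((hK' q hq x hx).mono (edgesWithin_mono Set.subset_union_right))
  exact fun x hx y hy => (h1 x hx).symm.trans (h1 y hy)

theorem ConnectedOn.union (hK : T.ConnectedOn K) (hK' : T.ConnectedOn K')
    (hp : p ∈ K) (hp' : p ∈ K') : T.ConnectedOn (K ∪ K') :=
  hK.union_of_reachable hK' hp hp' Reachable.rfl

theorem ConnectedOn.union_of_adj (hK : T.ConnectedOn K) (hK' : T.ConnectedOn K')
    (hp : p ∈ K) (hq : q ∈ K') (hpq : T.Adj p q) : T.ConnectedOn (K ∪ K') :=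
  hK.union_of_reachable hK' hp hq
    (Adj.reachable ⟨hpq, Set.mem_union_left _ hp, Set.mem_union_right _ hq⟩)

theorem mem_halfTree_self (p q : X) : q ∈ T.halfTree p q := Reachable.rfl

theorem mem_halfTree_of_adj (hx : x ∈ T.halfTree p q) (hxy : T.Adj x y) (hy : y ≠ p) :
    y ∈ T.halfTree p q := by
  by_cases h : s(x, y) = s(p, q)
  · rcases Sym2.eq_iff.1 h with ⟨-, rfl⟩ | ⟨-, rfl⟩
    · exact mem_halfTree_self _ _
    · exact absurd rfl hy
  · exact Reachable.trans hx (Adj.reachable (by simpa [hxy] using h))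

theorem connectedOn_halfTree (p q : X) : T.ConnectedOn (T.halfTree p q) := by
  have h1 : ∀ x ∈ T.halfTree p q, (T.edgesWithin (T.halfTree p q)).Reachable q x := by
    intro x hx
    refine (Reachable.induction_adj (Q := fun z => z ∈ T.halfTree p q ∧
      (T.edgesWithin (T.halfTree p q)).Reachable q z) hx
      ⟨mem_halfTree_self _ _, Reachable.rfl⟩ fun a b ha hab => ?_).2
    have hb : b ∈ T.halfTree p q := Reachable.trans ha.1 (Adj.reachable hab)
    exact ⟨hb, ha.2.trans (Adj.reachable ⟨(deleteEdges_le _ hab), ha.1, hb⟩)⟩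
  exact fun x hx y hy => (h1 x hx).symm.trans (h1 y hy)

namespace IsTree

/-- A connected subgraph of a tree contains every edge of the tree between two of its vertices. -/
theorem adj_of_reachable (hT : T.IsTree) {G : SimpleGraph X} (hG : G ≤ T) (hpq : T.Adj p q)
    (h : G.Reachable p q) : G.Adj p q := by
  by_contra hn
  refine isBridge_iff.1 (isAcyclic_iff_forall_adj_isBridge.1 hT.isAcyclic hpq) (h.mono ?_)
  intro a b hab
  rw [deleteEdges_adj]
  refine ⟨hG hab, fun he => hn ?_⟩
  rcases Sym2.eq_iff.1 he with ⟨rfl, rfl⟩ | ⟨rfl, rfl⟩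
  exacts [hab, hab.symm]

/-- A path inside `K` cannot use the edge from `p` to `q ∉ K`, and that edge is a bridge. -/
theorem notMem_halfTree (hT : T.IsTree) (hK : T.ConnectedOn K) (hpq : T.Adj p q) (hp : p ∈ K)
    (hq : q ∉ K) (hx : x ∈ K) : x ∉ T.halfTree p q := by
  intro h
  refine isBridge_iff.1 (isAcyclic_iff_forall_adj_isBridge.1 hT.isAcyclic hpq)
    (((hK p hp x hx).mono fun a b hab => ?_).trans h.symm)
  rw [deleteEdges_adj]
  refine ⟨hab.1, fun he => hq ?_⟩
  rcases Sym2.eq_iff.1 he with ⟨-, rfl⟩ | ⟨rfl, -⟩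
  exacts [hab.2.2, hab.2.1]

theorem notMem_halfTree_self (hT : T.IsTree) (hpq : T.Adj p q) : p ∉ T.halfTree p q :=
  hT.notMem_halfTree (connectedOn_singleton p) hpq rfl hpq.ne' rfl

theorem mem_halfTree_or (hT : T.IsTree) (p q x : X) : x ∈ T.halfTree p q ∨ x ∈ T.halfTree q p := by
  refine Reachable.induction_adj (Q := fun z => z ∈ T.halfTree p q ∨ z ∈ T.halfTree q p)
    (hT.connected.preconnected p x) (Or.inr (mem_halfTree_self _ _)) fun a b ha hab => ?_
  rcases ha with ha | ha
  · by_cases hb : b = p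
    · exact Or.inr (hb ▸ mem_halfTree_self _ _)
    · exact Or.inl (mem_halfTree_of_adj ha hab hb)
  · by_cases hb : b = q
    · exact Or.inl (hb ▸ mem_halfTree_self _ _)
    · exact Or.inr (mem_halfTree_of_adj ha hab hb)

/-- A connected set that contains `q` but not `p` lies on the side of `q`. -/
theorem subset_halfTree (hT : T.IsTree) (hK : T.ConnectedOn K) (hpq : T.Adj p q) (hp : p ∉ K)
    (hq : q ∈ K) : K ⊆ T.halfTree p q := fun x hx =>
  (hT.mem_halfTree_or p q x).resolve_right (hT.notMem_halfTree hK hpq.symm hq hp hx)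

/-- The half-trees hanging off a connected set at different edges are disjoint. -/
theorem eq_of_mem_halfTree (hT : T.IsTree) (hK : T.ConnectedOn K) (hp : p ∈ K) (hp' : p' ∉ K)
    (hq : q ∈ K) (hq' : q' ∉ K) (hpp : T.Adj p p') (hqq : T.Adj q q')
    (hx : x ∈ T.halfTree p p') (hx' : x ∈ T.halfTree q q') : p = q ∧ p' = q' := by
  by_contra hne
  -- If `p = q`, apply the bridge argument to `{p, p'}`; otherwise `p'` would drag its neighbour `p
  -- ∈ K` into the half-tree.
  have hdis : p' ∉ T.halfTree q q' := by
    intro h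
    by_cases hpq : p = q
    · subst hpq
      have h2 : p' ≠ q' := fun h => hne ⟨rfl, h⟩
      have h3 : T.ConnectedOn ({p} ∪ {p'}) :=
        (connectedOn_singleton p).union_of_adj (connectedOn_singleton p') rfl rfl hpp
      refine hT.notMem_halfTree h3 hqq (Or.inl rfl) ?_ (Or.inr rfl) h
      rintro (rfl | rfl)
      exacts [hq' hp, h2 rfl]
    · exact hT.notMem_halfTree hK hqq hq hq' hp (mem_halfTree_of_adj h hpp.symm hpq)
  -- This connected set contains `p` and avoids `p'`, so it has no point beyond `p'`.
  have h4 : T.ConnectedOn (K ∪ T.halfTree q q') :=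
    hK.union_of_adj (connectedOn_halfTree q q') hq (mem_halfTree_self _ _) hqq
  refine hT.notMem_halfTree h4 hpp (Or.inl hp) ?_ (Or.inr hx') hx
  rintro (h | h)
  exacts [hp' h, hdis h]

/-- Seen from `q`, the half-trees towards `p` and towards `x` are disjoint. -/
theorem halfTree_subset_halfTree (hT : T.IsTree) (hpq : T.Adj p q) (hqx : T.Adj q x)
    (hpx : p ≠ x) : T.halfTree q x ⊆ T.halfTree p q := by
  intro z hz
  refine (hT.mem_halfTree_or p q z).resolve_right fun h => hpx ?_
  exact (hT.eq_of_mem_halfTree (connectedOn_singleton q) rfl hpq.ne rfl hqx.ne' hpq.symm hqx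
    h hz).2

theorem exists_mem_halfTree (hT : T.IsTree) (hp : p ∈ K) (x : X) :
    x ∈ K ∨ ∃ c ∈ K, ∃ c' ∉ K, T.Adj c c' ∧ x ∈ T.halfTree c c' := by
  refine Reachable.induction_adj (Q := fun x => x ∈ K ∨ ∃ c ∈ K, ∃ c' ∉ K, T.Adj c c' ∧
    x ∈ T.halfTree c c') (hT.connected.preconnected p x) (Or.inl hp) fun a b ha hab => ?_
  by_cases hb : b ∈ K
  · exact Or.inl hb
  refine Or.inr ?_
  rcases ha with ha | ⟨c, hc, c', hc', hcc, ha⟩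
  · exact ⟨a, ha, b, hb, hab, mem_halfTree_self _ _⟩
  · exact ⟨c, hc, c', hc', hcc, mem_halfTree_of_adj ha hab fun h => hb (h ▸ hc)⟩

/-- If two connected sets have two common vertices `p ≠ x`, they have a common edge at `p`. -/
theorem exists_adj_mem_inter (hT : T.IsTree) (hK : T.ConnectedOn K) (hK' : T.ConnectedOn K')
    (hp : p ∈ K) (hp' : p ∈ K') (hx : x ∈ K) (hx' : x ∈ K') (hne : x ≠ p) :
    ∃ q, T.Adj p q ∧ q ∈ K ∧ q ∈ K' := by
  rcases hT.exists_mem_halfTree (K := {p}) rfl x with h | ⟨c, rfl, q, -, hcq, hq⟩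
  · exact absurd h hne
  · refine ⟨q, hcq, ?_, ?_⟩
    · by_contra h
      exact hT.notMem_halfTree hK hcq hp h hx hq
    · by_contra h
      exact hT.notMem_halfTree hK' hcq hp' h hx' hq

/-- A vertex outside a connected set has at most one neighbour in it. -/
theorem eq_of_adj_of_adj (hT : T.IsTree) (hK : T.ConnectedOn K) (hp : p ∈ K) (hq : q ∈ K)
    (hx : x ∉ K) (hpx : T.Adj p x) (hqx : T.Adj q x) : p = q :=
  (hT.eq_of_mem_halfTree hK hp hx hq hx hpx hqx (mem_halfTree_self _ _)
    (mem_halfTree_self _ _)).1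

end IsTree

end SimpleGraph

/-! ### Automorphisms acting on half-trees. -/

section Action

open SimpleGraph

variable {Γ X : Type*} [Group Γ] [MulAction Γ X] {T : SimpleGraph X} {K : Set X} {p q x y : X}

theorem SimpleGraph.adj_smul_iff (hact : ∀ (g : Γ) (x y : X), T.Adj x y → T.Adj (g • x) (g • y))
    (g : Γ) : T.Adj (g • x) (g • y) ↔ T.Adj x y :=
  ⟨fun h => by simpa using hact g⁻¹ _ _ h, hact g x y⟩

theorem SimpleGraph.smul_mem_halfTree
    (hact : ∀ (g : Γ) (x y : X), T.Adj x y → T.Adj (g • x) (g • y)) (g : Γ)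
    (hx : x ∈ T.halfTree p q) : g • x ∈ T.halfTree (g • p) (g • q) := by
  refine Reachable.map (G' := T.deleteEdges {s(g • p, g • q)}) ⟨fun z => g • z, ?_⟩ hx
  intro a b hab
  rw [deleteEdges_adj] at hab ⊢
  refine ⟨hact g _ _ hab.1, fun h => hab.2 ?_⟩
  simpa [Sym2.eq_iff] using h

theorem SimpleGraph.ConnectedOn.smul
    (hact : ∀ (g : Γ) (x y : X), T.Adj x y → T.Adj (g • x) (g • y)) (hK : T.ConnectedOn K)
    (g : Γ) : T.ConnectedOn (g • K) := by
  rintro _ ⟨x, hx, rfl⟩ _ ⟨y, hy, rfl⟩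
  refine Reachable.map (G' := T.edgesWithin (g • K)) ⟨fun z => g • z, ?_⟩ (hK x hx y hy)
  intro a b hab
  exact ⟨hact g _ _ hab.1, Set.smul_mem_smul_set hab.2.1, Set.smul_mem_smul_set hab.2.2⟩

/-- An automorphism of a tree that preserves a nonempty connected set and fixes a vertex fixes a
vertex of the set. -/
theorem SimpleGraph.IsTree.exists_fixed_mem (hT : T.IsTree)
    (hact : ∀ (g : Γ) (x y : X), T.Adj x y → T.Adj (g • x) (g • y)) (hK : T.ConnectedOn K)
    (hp : p ∈ K) {g : Γ} (hg : ∀ x, g • x ∈ K ↔ x ∈ K) (hx : g • x = x) :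
    ∃ c ∈ K, g • c = c := by
  rcases hT.exists_mem_halfTree hp x with h | ⟨c, hc, c', hc', hcc, h⟩
  · exact ⟨x, h, hx⟩
  · have h2 := smul_mem_halfTree hact g h
    rw [hx] at h2
    exact ⟨c, hc, (hT.eq_of_mem_halfTree hK hc hc' ((hg c).2 hc) (fun h => hc' ((hg c').1 h)) hcc
      (hact g _ _ hcc) h h2).1.symm⟩

end Action

/-! ### Cores of free subgroups and finiteness modulo the subgroup. -/

section Core

open SimpleGraph

variable {Γ X : Type*} [Group Γ] [MulAction Γ X] {T : SimpleGraph X} {Λ : Subgroup Γ} {C : Set X}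
  {p q x y : X}

/-- No nontrivial element of `Λ` fixes a point of `X`. -/
def Subgroup.ActsFreely (Λ : Subgroup Γ) (X : Type*) [MulAction Γ X] : Prop :=
  ∀ g ∈ Λ, ∀ x : X, g • x = x → g = 1

theorem Subgroup.ActsFreely.eq (hf : Λ.ActsFreely X) {g h : Γ} (hg : g ∈ Λ) (hh : h ∈ Λ)
    (h2 : g • x = h • x) : g = h := by
  have := hf (h⁻¹ * g) (Λ.mul_mem (Λ.inv_mem hh) hg) x (by rw [mul_smul, h2, inv_smul_smul])
  exact (inv_mul_eq_one.1 this).symm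

/-- A `Λ`-invariant subtree with finitely many vertices and edges modulo `Λ`. -/
structure IsCore (T : SimpleGraph X) (Λ : Subgroup Γ) (C : Set X) : Prop where
  smul_mem : ∀ g ∈ Λ, ∀ x ∈ C, g • x ∈ C
  connectedOn : T.ConnectedOn C
  exists_finite : ∃ E : Set (X × X), E.Finite ∧ ∀ p ∈ C, ∀ q ∈ C, (p = q ∨ T.Adj p q) →
    ∃ g ∈ Λ, ∃ e ∈ E, g • e.1 = p ∧ g • e.2 = q

theorem IsCore.smul_mem_iff (hC : IsCore T Λ C) {g : Γ} (hg : g ∈ Λ) : g • x ∈ C ↔ x ∈ C :=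
  ⟨fun h => by simpa using hC.smul_mem g⁻¹ (Λ.inv_mem hg) _ h, hC.smul_mem g hg x⟩

/-- By freeness each representative edge has at most one translate starting at `p`. -/
theorem IsCore.finite_neighbors (hC : IsCore T Λ C) (hf : Λ.ActsFreely X) (p : X) :
    {q | p ∈ C ∧ q ∈ C ∧ T.Adj p q}.Finite := by
  obtain ⟨E, hE, h⟩ := hC.exists_finite
  refine (hE.biUnion (t := fun e => {q | ∃ g ∈ Λ, g • e.1 = p ∧ g • e.2 = q})
    fun e _ => Set.Subsingleton.finite ?_).subset ?_
  · rintro _ ⟨g, hg, h1, rfl⟩ _ ⟨g', hg', h1', rfl⟩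
    rw [hf.eq hg hg' (h1.trans h1'.symm)]
  · rintro q ⟨hp, hq, hpq⟩
    obtain ⟨g, hg, e, he, h1⟩ := h p hp q hq (Or.inr hpq)
    exact Set.mem_biUnion he ⟨g, hg, h1⟩

theorem isCore_singleton_bot (x : X) : IsCore T (⊥ : Subgroup Γ) {x} := by
  refine ⟨?_, connectedOn_singleton x, {(x, x)}, Set.finite_singleton _, ?_⟩
  · rintro g hg y rfl
    rw [Subgroup.mem_bot.1 hg, one_smul]
    rfl
  · rintro p rfl q rfl -
    exact ⟨1, Subgroup.one_mem _, _, rfl, one_smul _ _, one_smul _ _⟩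

/-- The whole orbit `Λ b` is added. In a tree each of its points has a single neighbour in `C` and
no two of them are adjacent, so the only new orbits are those of `b` and of the edge to `a`. -/
theorem IsCore.exists_insert_adj (hC : IsCore T Λ C) (hT : T.IsTree)
    (hact : ∀ (g : Γ) (x y : X), T.Adj x y → T.Adj (g • x) (g • y))
    {a b : X} (ha : a ∈ C) (hab : T.Adj a b) : ∃ C', IsCore T Λ C' ∧ C ⊆ C' ∧ b ∈ C' := by
  by_cases hb : b ∈ C
  · exact ⟨C, hC, subset_rfl, hb⟩
  have hb' : ∀ g ∈ Λ, g • b ∉ C := fun g hg h => hb ((hC.smul_mem_iff hg).1 h)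
  have ha' : ∀ g ∈ Λ, g • a ∈ C := fun g hg => hC.smul_mem g hg a ha
  refine ⟨C ∪ {x | ∃ g ∈ Λ, g • b = x}, ⟨?_, ?_, ?_⟩, Set.subset_union_left,
    Or.inr ⟨1, Λ.one_mem, one_smul _ _⟩⟩
  · rintro g hg x (hx | ⟨g', hg', rfl⟩)
    · exact Or.inl (hC.smul_mem g hg x hx)
    · exact Or.inr ⟨g * g', Λ.mul_mem hg hg', mul_smul _ _ _⟩
  · have h1 : ∀ x ∈ C, (T.edgesWithin (C ∪ {x | ∃ g ∈ Λ, g • b = x})).Reachable a x := fun x hx =>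
      (hC.connectedOn a ha x hx).mono (edgesWithin_mono Set.subset_union_left)
    have h2 : ∀ x ∈ C ∪ {x | ∃ g ∈ Λ, g • b = x},
        (T.edgesWithin (C ∪ {x | ∃ g ∈ Λ, g • b = x})).Reachable a x := by
      rintro x (hx | ⟨g, hg, rfl⟩)
      · exact h1 x hx
      · exact (h1 (g • a) (ha' g hg)).trans (Adj.reachable
          ⟨hact g _ _ hab, Or.inl (ha' g hg), Or.inr ⟨g, hg, rfl⟩⟩)
    exact fun x hx y hy => (h2 x hx).symm.trans (h2 y hy)
  · obtain ⟨E, hE, h⟩ := hC.exists_finite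
    refine ⟨E ∪ {(a, b), (b, a), (b, b)}, hE.union (by simp), ?_⟩
    rintro p (hp | ⟨g, hg, rfl⟩) q (hq | ⟨g', hg', rfl⟩) hpq
    · obtain ⟨g, hg, e, he, h1⟩ := h p hp q hq hpq
      exact ⟨g, hg, e, Or.inl he, h1⟩
    · rcases hpq with rfl | hpq
      · exact absurd hp (hb' _ hg')
      · exact ⟨g', hg', (a, b), by simp, hT.eq_of_adj_of_adj hC.connectedOn (ha' g' hg') hp
          (hb' _ hg') (hact _ _ _ hab) hpq, rfl⟩
    · rcases hpq with rfl | hpq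
      · exact absurd hq (hb' _ hg)
      · exact ⟨g, hg, (b, a), by simp, rfl, hT.eq_of_adj_of_adj hC.connectedOn (ha' g hg) hq
          (hb' _ hg) (hact _ _ _ hab) hpq.symm⟩
    · rcases hpq with hpq | hpq
      · exact ⟨g, hg, (b, b), by simp, rfl, hpq⟩
      · exfalso
        have h1 : g' • b ∈ T.halfTree (g • a) (g • b) :=
          mem_halfTree_of_adj (mem_halfTree_self _ _) hpq fun h => hb' g' hg' (h ▸ ha' g hg)
        have h2 := hT.eq_of_mem_halfTree hC.connectedOn (ha' g hg) (hb' g hg) (ha' g' hg')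
          (hb' g' hg') (hact _ _ _ hab) (hact _ _ _ hab) h1 (mem_halfTree_self _ _)
        exact hpq.ne h2.2

theorem IsCore.exists_insert (hC : IsCore T Λ C) (hT : T.IsTree)
    (hact : ∀ (g : Γ) (x y : X), T.Adj x y → T.Adj (g • x) (g • y))
    (hp : p ∈ C) (x : X) : ∃ C', IsCore T Λ C' ∧ C ⊆ C' ∧ x ∈ C' := by
  refine Reachable.induction_adj (Q := fun x => ∃ C', IsCore T Λ C' ∧ C ⊆ C' ∧ x ∈ C')
    (hT.connected.preconnected p x) ⟨C, hC, subset_rfl, hp⟩ ?_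
  rintro a b ⟨C', hC', h, ha⟩ hab
  obtain ⟨C'', hC'', h', hb⟩ := hC'.exists_insert_adj hT hact ha hab
  exact ⟨C'', hC'', h.trans h', hb⟩

theorem IsCore.exists_superset (hC : IsCore T Λ C) (hT : T.IsTree)
    (hact : ∀ (g : Γ) (x y : X), T.Adj x y → T.Adj (g • x) (g • y))
    (hp : p ∈ C) {S : Set X} (hS : S.Finite) : ∃ C', IsCore T Λ C' ∧ C ⊆ C' ∧ S ⊆ C' := by
  induction S, hS using Set.Finite.induction_on with
  | empty => exact ⟨C, hC, subset_rfl, Set.empty_subset _⟩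
  | insert _ _ ih =>
    obtain ⟨C', hC', h, hS⟩ := ih
    obtain ⟨C'', hC'', hsub, hx⟩ := hC'.exists_insert hT hact (h hp) _
    exact ⟨C'', hC'', h.trans hsub, Set.insert_subset hx (hS.trans hsub)⟩

/-- `Δ` is contained in a finite union of double cosets of `Λ`. -/
def Subgroup.FiniteDouble (Λ : Subgroup Γ) (Δ : Set Γ) : Prop :=
  ∃ D : Set Γ, D.Finite ∧ ∀ σ ∈ Δ, ∃ d ∈ D, ∃ g ∈ Λ, ∃ h ∈ Λ, σ = g * d * h

theorem finite_smul_eq_of_adj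
    (hfin : ∀ x y : X, T.Adj x y → Finite (edgeStabilizer Γ x y)) {a b : X} (hab : T.Adj a b)
    (p q : X) : {g : Γ | g • a = p ∧ g • b = q}.Finite := by
  by_cases h : ∃ g₀ : Γ, g₀ • a = p ∧ g₀ • b = q
  · obtain ⟨g₀, rfl, rfl⟩ := h
    have := hfin a b hab
    refine ((edgeStabilizer Γ a b : Set Γ).toFinite.image (fun s => g₀ * s)).subset ?_
    rintro g ⟨h1, h2⟩
    refine ⟨g₀⁻¹ * g, ?_, mul_inv_cancel_left _ _⟩
    refine Subgroup.mem_inf.2 ⟨MulAction.mem_stabilizer_iff.2 ?_, MulAction.mem_stabilizer_iff.2 ?_⟩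
    · rw [mul_smul, h1, inv_smul_smul]
    · rw [mul_smul, h2, inv_smul_smul]
  · refine Set.finite_empty.subset fun g hg => h ⟨g, hg⟩

/-- Finitely many translates of a core by a finite union of double cosets pass through a given
vertex of the core. -/
theorem IsCore.finite_cosets (hC : IsCore T Λ C) (hf : Λ.ActsFreely X) (hT : T.IsTree)
    (hact : ∀ (g : Γ) (x y : X), T.Adj x y → T.Adj (g • x) (g • y))
    (hfin : ∀ x y : X, T.Adj x y → Finite (edgeStabilizer Γ x y))
    {Δ : Set Γ} (hΔ : Λ.FiniteDouble Δ) (hp : p ∈ C) :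
    ∃ M : Set Γ, M.Finite ∧ ∀ σ ∈ Δ, p ∈ σ • C → ∃ m ∈ M, ∃ g ∈ Λ, σ = m * g := by
  obtain ⟨D, hD, hΔ⟩ := hΔ
  obtain ⟨E, hE, hEC⟩ := hC.exists_finite
  let N := {q | p ∈ C ∧ q ∈ C ∧ T.Adj p q}
  have hN : N.Finite := hC.finite_neighbors hf p
  let M₁ : Set Γ := ⋃ q ∈ N, ⋃ e ∈ E, {m | T.Adj e.1 e.2 ∧ m • e.1 = p ∧ m • e.2 = q}
  have hM₁ : M₁.Finite := by
    refine hN.biUnion fun q _ => hE.biUnion fun e _ => ?_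
    by_cases he : T.Adj e.1 e.2
    · exact (finite_smul_eq_of_adj hfin he p q).subset fun m hm => hm.2
    · exact Set.finite_empty.subset fun m hm => he hm.1
  let Q : Γ → Γ → Prop := fun d σ => (∃ g ∈ Λ, ∃ h ∈ Λ, σ = g * d * h) ∧ p ∈ σ • C ∧
    ∀ x ∈ C, x ∈ σ • C → x = p
  classical
  -- One translate through `p` that meets the core only there is chosen per double coset; the
  -- default `1` plays no role.
  let F : Γ → Γ := fun d => if h : ∃ σ, Q d σ then h.choose else 1
  refine ⟨M₁ ∪ F '' D, hM₁.union (hD.image F), fun σ hσ hpσ => ?_⟩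
  obtain ⟨d, hd, g, hg, h, hh, hσd⟩ := hΔ σ hσ
  -- A second common vertex yields a common edge at `p`, and finite edge stabilizers leave finitely
  -- many cosets.
  by_cases hex : ∃ x ∈ C, x ∈ σ • C ∧ x ≠ p
  · obtain ⟨x, hx, hxσ, hne⟩ := hex
    obtain ⟨q, hpq, hq, hqσ⟩ := hT.exists_adj_mem_inter hC.connectedOn (hC.connectedOn.smul hact σ)
      hp hpσ hx hxσ hne
    rw [Set.mem_smul_set_iff_inv_smul_mem] at hpσ hqσ
    obtain ⟨k, hk, e, he, h1, h2⟩ := hEC _ hpσ _ hqσ (Or.inr (hact _ _ _ hpq))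
    refine ⟨σ * k, Or.inl (Set.mem_biUnion (show q ∈ N from ⟨hp, hq, hpq⟩)
      (Set.mem_biUnion he ⟨?_, ?_, ?_⟩)), k⁻¹, Λ.inv_mem hk, by group⟩
    · rw [← adj_smul_iff hact k, h1, h2]
      exact hact _ _ _ hpq
    · rw [mul_smul, h1, smul_inv_smul]
    · rw [mul_smul, h2, smul_inv_smul]
  · push Not at hex
    have hQ : ∃ σ, Q d σ := ⟨σ, ⟨g, hg, h, hh, hσd⟩, hpσ, hex⟩
    refine ⟨F d, Or.inr ⟨d, hd, rfl⟩, ?_⟩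
    have hFd : F d = hQ.choose := dif_pos hQ
    obtain ⟨⟨g', hg', h', hh', hτd⟩, hpτ, -⟩ := hQ.choose_spec
    rw [← hFd] at hτd hpτ
    -- This element sends `p` into `C ∩ σ C = {p}`; by freeness it is trivial, so `σ` and `F d` lie
    -- in the same left coset of `Λ`.
    have hk : g * g'⁻¹ ∈ Λ := Λ.mul_mem hg (Λ.inv_mem hg')
    have heq : σ = (g * g'⁻¹) * F d * (h'⁻¹ * h) := by rw [hτd, hσd]; group
    have hmem : (g * g'⁻¹) • p ∈ σ • C := by
      rw [Set.mem_smul_set_iff_inv_smul_mem] at hpτ ⊢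
      have : σ⁻¹ • (g * g'⁻¹) • p = (h'⁻¹ * h)⁻¹ • (F d)⁻¹ • p := by
        rw [heq]; simp only [smul_smul]; congr 1; group
      rw [this]
      exact hC.smul_mem _ (Λ.inv_mem (Λ.mul_mem (Λ.inv_mem hh') hh)) _ hpτ
    have h1 := hf _ hk p (hex _ (hC.smul_mem _ hk p hp) hmem)
    exact ⟨h'⁻¹ * h, Λ.mul_mem (Λ.inv_mem hh') hh, by rw [heq, h1, one_mul]⟩

end Core

/-! ### Free extensions of a subgroup by ping-pong. -/

section Gluing

open SimpleGraph

variable {Γ X L : Type*} [Group Γ] [MulAction Γ X] {T : SimpleGraph X} {Λ : Subgroup Γ} {C : Set X}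
  {bar : L → L} {θ : L → Γ} {o t : L → X} {l l' : L} {x y : X}

/-- Data for a free extension of `Λ` by elements `θ l`: the edge from `o l` to `t l` leaves the
core `C` at `t l`, and `θ l` matches the vertex `t (bar l)` with `t l`. -/
structure IsGluing (T : SimpleGraph X) (Λ : Subgroup Γ) (C : Set X) (bar : L → L) (θ : L → Γ)
    (o t : L → X) : Prop where
  bar_bar : ∀ l, bar (bar l) = l
  bar_ne : ∀ l, bar l ≠ l
  map_bar : ∀ l, θ (bar l) = (θ l)⁻¹
  mem : ∀ l, o l ∈ C
  notMem : ∀ l, t l ∉ C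
  adj : ∀ l, T.Adj (o l) (t l)
  smul_eq : ∀ l, θ l • t (bar l) = t l
  smul_ne : ∀ l, θ l • o (bar l) ≠ o l
  free : ∀ g ∈ Λ, ∀ l m, g • t l = t m → g = 1 ∧ l = m

/-- Reduced words in `Λ` and the letters `θ l` that start with the given letter. -/
inductive IsReducedWord (Λ : Subgroup Γ) (bar : L → L) (θ : L → Γ) : L → Γ → Prop
  | single (l : L) (g : Γ) (hg : g ∈ Λ) : IsReducedWord Λ bar θ l (θ l * g)
  | cons (l : L) (g : Γ) (hg : g ∈ Λ) (l' : L) (w : Γ) (hw : IsReducedWord Λ bar θ l' w)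
      (h : g = 1 → l' ≠ bar l) : IsReducedWord Λ bar θ l (θ l * (g * w))

/-- The subgroup generated by `Λ` and the elements `θ l`. -/
def gluedSubgroup (Λ : Subgroup Γ) (θ : L → Γ) : Subgroup Γ :=
  Subgroup.closure ((Λ : Set Γ) ∪ Set.range θ)

theorem le_gluedSubgroup (Λ : Subgroup Γ) (θ : L → Γ) : Λ ≤ gluedSubgroup Λ θ :=
  fun _ hg => Subgroup.subset_closure (Or.inl hg)

theorem mem_gluedSubgroup (Λ : Subgroup Γ) (θ : L → Γ) (l : L) : θ l ∈ gluedSubgroup Λ θ :=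
  Subgroup.subset_closure (Or.inr ⟨l, rfl⟩)

namespace IsGluing

theorem mul_mem_or_reduced (hG : IsGluing T Λ C bar θ o t) (l : L) {w : Γ}
    (hw : w ∈ Λ ∨ ∃ g ∈ Λ, ∃ l v, IsReducedWord Λ bar θ l v ∧ w = g * v) :
    θ l * w ∈ Λ ∨ ∃ g ∈ Λ, ∃ l' v, IsReducedWord Λ bar θ l' v ∧ θ l * w = g * v := by
  rcases hw with hw | ⟨g, hg, l', v, hv, rfl⟩
  · exact Or.inr ⟨1, Λ.one_mem, l, _, .single l w hw, (one_mul _).symm⟩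
  by_cases h : g = 1 → l' ≠ bar l
  · exact Or.inr ⟨1, Λ.one_mem, l, _, .cons l g hg l' v hv h, (one_mul _).symm⟩
  push Not at h
  obtain ⟨rfl, rfl⟩ := h
  cases hv with
  | single _ g hg =>
    left
    rwa [hG.map_bar, one_mul, mul_inv_cancel_left]
  | cons _ g hg l' w hw h =>
    exact Or.inr ⟨g, hg, l', w, hw, by rw [hG.map_bar, one_mul, mul_inv_cancel_left]⟩

theorem mem_or_reduced (hG : IsGluing T Λ C bar θ o t) {w : Γ} (hw : w ∈ gluedSubgroup Λ θ) :
    w ∈ Λ ∨ ∃ g ∈ Λ, ∃ l v, IsReducedWord Λ bar θ l v ∧ w = g * v := by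
  have hΛ : ∀ k ∈ Λ, ∀ w, (w ∈ Λ ∨ ∃ g ∈ Λ, ∃ l v, IsReducedWord Λ bar θ l v ∧ w = g * v) →
      (k * w ∈ Λ ∨ ∃ g ∈ Λ, ∃ l v, IsReducedWord Λ bar θ l v ∧ k * w = g * v) := by
    rintro k hk w (hw | ⟨g, hg, l, v, hv, rfl⟩)
    · exact Or.inl (Λ.mul_mem hk hw)
    · exact Or.inr ⟨k * g, Λ.mul_mem hk hg, l, v, hv, (mul_assoc _ _ _).symm⟩
  induction hw using Subgroup.closure_induction_left with
  | one => exact Or.inl Λ.one_mem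
  | mul_left x hx y _ ih =>
    rcases hx with hx | ⟨l, rfl⟩
    · exact hΛ x hx y ih
    · exact hG.mul_mem_or_reduced l ih
  | inv_mul_cancel x hx y _ ih =>
    rcases hx with hx | ⟨l, rfl⟩
    · exact hΛ _ (Λ.inv_mem hx) y ih
    · rw [← hG.map_bar]
      exact hG.mul_mem_or_reduced _ ih

theorem notMem_halfTree (hT : T.IsTree) (hG : IsGluing T Λ C bar θ o t) (hC : IsCore T Λ C)
    (hx : x ∈ C) : x ∉ T.halfTree (o l) (t l) :=
  hT.notMem_halfTree hC.connectedOn (hG.adj l) (hG.mem l) (hG.notMem l) hx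

theorem notMem_smul_halfTree (hT : T.IsTree) (hG : IsGluing T Λ C bar θ o t) (hC : IsCore T Λ C)
    {g : Γ} (hg : g ∈ Λ) (hx : x ∈ T.halfTree (o l) (t l)) : g • x ∉ C := fun h =>
  hG.notMem_halfTree hT hC ((hC.smul_mem_iff hg).1 h) hx

theorem eq_of_smul_mem (hT : T.IsTree)
    (hact : ∀ (g : Γ) (x y : X), T.Adj x y → T.Adj (g • x) (g • y))
    (hG : IsGluing T Λ C bar θ o t) (hC : IsCore T Λ C) {g : Γ} (hg : g ∈ Λ)
    (hx : x ∈ T.halfTree (o l) (t l)) (hgx : g • x ∈ T.halfTree (o l') (t l')) :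
    g = 1 ∧ l = l' :=
  hG.free g hg l l' (hT.eq_of_mem_halfTree hC.connectedOn (hC.smul_mem g hg _ (hG.mem l))
    (fun h => hG.notMem l ((hC.smul_mem_iff hg).1 h)) (hG.mem l') (hG.notMem l')
    (hact _ _ _ (hG.adj l)) (hG.adj l') (smul_mem_halfTree hact g hx) hgx).2

/-- The ping-pong step: `θ l` moves `x` to the side of `θ l • o (bar l)`, seen from `t l`. As this
neighbour is not `o l`, that side lies beyond `t l`. -/
theorem smul_mem_halfTree (hT : T.IsTree)
    (hact : ∀ (g : Γ) (x y : X), T.Adj x y → T.Adj (g • x) (g • y))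
    (hG : IsGluing T Λ C bar θ o t)
    (hx : x ∉ T.halfTree (o (bar l)) (t (bar l))) : θ l • x ∈ T.halfTree (o l) (t l) := by
  have h1 := SimpleGraph.smul_mem_halfTree hact (θ l) ((hT.mem_halfTree_or _ _ x).resolve_left hx)
  rw [hG.smul_eq] at h1
  refine hT.halfTree_subset_halfTree (hG.adj l) ?_ (hG.smul_ne l).symm h1
  have := hact (θ l) _ _ (hG.adj (bar l)).symm
  rwa [hG.smul_eq] at this

/-- Ping-pong along the word: by `free`, landing in the excluded half-tree would mean a
cancellation. -/
theorem reduced_smul_mem (hT : T.IsTree)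
    (hact : ∀ (g : Γ) (x y : X), T.Adj x y → T.Adj (g • x) (g • y))
    (hG : IsGluing T Λ C bar θ o t) (hC : IsCore T Λ C) {w : Γ}
    (hw : IsReducedWord Λ bar θ l w) (hx : x ∈ C) : w • x ∈ T.halfTree (o l) (t l) := by
  induction hw with
  | single l g hg =>
    rw [mul_smul]
    exact hG.smul_mem_halfTree hT hact (hG.notMem_halfTree hT hC (hC.smul_mem g hg x hx))
  | cons l g hg l' w _ h ih =>
    rw [mul_smul, mul_smul]
    refine hG.smul_mem_halfTree hT hact fun h2 => ?_
    obtain ⟨h3, h4⟩ := hG.eq_of_smul_mem hT hact hC hg ih h2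
    exact h h3 h4

/-- A neighbour of `t l` other than `o l` lies beyond `t l`, which determines the first letter. -/
theorem eq_of_adj_smul (hT : T.IsTree)
    (hact : ∀ (g : Γ) (x y : X), T.Adj x y → T.Adj (g • x) (g • y))
    (hG : IsGluing T Λ C bar θ o t) (hC : IsCore T Λ C) {g v : Γ}
    (hg : g ∈ Λ) (hv : IsReducedWord Λ bar θ l' v) (hx : x ∈ C) (h : T.Adj (t l) (g • v • x)) :
    g = 1 ∧ l' = l := by
  have h1 := hG.reduced_smul_mem hT hact hC hv hx
  refine hG.eq_of_smul_mem hT hact hC hg h1 ?_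
  exact mem_halfTree_of_adj (mem_halfTree_self _ _) h fun h3 =>
    hG.notMem_smul_halfTree hT hC hg h1 (h3 ▸ hG.mem l)

/-- Since `o l` goes to a neighbour of `t l`, a word outside `Λ` starts with `θ l`. The remainder
maps `t l` to `t (bar l)`: in `Λ` this is excluded by `free`, and otherwise it starts with `bar l`,
against reducedness. -/
theorem eq_one_of_smul_eq (hT : T.IsTree)
    (hact : ∀ (g : Γ) (x y : X), T.Adj x y → T.Adj (g • x) (g • y))
    (hG : IsGluing T Λ C bar θ o t) (hC : IsCore T Λ C)
    {w : Γ} (hw : w ∈ gluedSubgroup Λ θ) (h : w • t l = t l) : w = 1 := by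
  have hbar : (θ l)⁻¹ • t l = t (bar l) := by rw [inv_smul_eq_iff, hG.smul_eq]
  rcases hG.mem_or_reduced hw with hw | ⟨g, hg, l', v, hv, rfl⟩
  · exact (hG.free w hw l l h).1
  exfalso
  have h1 := hact (g * v) _ _ (hG.adj l).symm
  rw [h, mul_smul] at h1
  obtain ⟨rfl, rfl⟩ := hG.eq_of_adj_smul hT hact hC hg hv (hG.mem _) h1
  rw [one_mul] at h
  cases hv with
  | single _ g hg =>
    rw [mul_smul, ← eq_inv_smul_iff, hbar] at h
    exact hG.bar_ne _ (hG.free g hg _ _ h).2.symm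
  | cons _ g hg m u hu hne =>
    rw [mul_smul, ← eq_inv_smul_iff, hbar] at h
    have h2 := hact (g * u) _ _ (hG.adj l').symm
    rw [h, mul_smul] at h2
    obtain ⟨h3, h4⟩ := hG.eq_of_adj_smul hT hact hC hg hu (hG.mem _) h2
    exact hne h3 h4

/-- The union of the translates of the core and of the attached vertices. -/
def core (Λ : Subgroup Γ) (C : Set X) (θ : L → Γ) (t : L → X) : Set X :=
  {x | ∃ w ∈ gluedSubgroup Λ θ, ∃ y ∈ C ∪ Set.range t, w • y = x}

/-- A fixed vertex may be taken in the core and then, after conjugation, in `C` or equal to some `t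
l`. On `C` ping-pong leaves only elements of `Λ`. -/
theorem actsFreely (hT : T.IsTree)
    (hact : ∀ (g : Γ) (x y : X), T.Adj x y → T.Adj (g • x) (g • y))
    (hG : IsGluing T Λ C bar θ o t) (hC : IsCore T Λ C) (hf : Λ.ActsFreely X)
    (hconn : T.ConnectedOn (core Λ C θ t)) (hx : x ∈ C) :
    (gluedSubgroup Λ θ).ActsFreely X := by
  intro w hw z hz
  have hinv : ∀ g ∈ gluedSubgroup Λ θ, ∀ x ∈ core Λ C θ t, g • x ∈ core Λ C θ t := by
    rintro g hg _ ⟨w, hw, y, hy, rfl⟩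
    exact ⟨g * w, mul_mem hg hw, y, hy, mul_smul _ _ _⟩
  obtain ⟨_, ⟨u, hu, y, hy, rfl⟩, hc⟩ := hT.exists_fixed_mem hact hconn
    (p := x) ⟨1, one_mem _, x, Or.inl hx, one_smul _ _⟩ (g := w)
    (fun z => ⟨fun h => by simpa using hinv _ (inv_mem hw) _ h, hinv w hw z⟩) hz
  have hy' : (u⁻¹ * w * u) • y = y := by
    rw [mul_smul, mul_smul, hc, inv_smul_smul]
  have hmem : u⁻¹ * w * u ∈ gluedSubgroup Λ θ := mul_mem (mul_mem (inv_mem hu) hw) hu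
  have h1 : u⁻¹ * w * u = 1 := by
    rcases hy with hy | ⟨l, rfl⟩
    · rcases hG.mem_or_reduced hmem with h | ⟨g, hg, l, v, hv, h⟩
      · exact hf _ h _ hy'
      · rw [h, mul_smul] at hy'
        exact absurd hy (hy' ▸ hG.notMem_smul_halfTree hT hC hg
          (hG.reduced_smul_mem hT hact hC hv hy))
    · exact hG.eq_one_of_smul_eq hT hact hC hmem hy'
  have h2 : w = u * (u⁻¹ * w * u) * u⁻¹ := by group
  rw [h2, h1, mul_one, mul_inv_cancel]

/-- The vertex `t l` is common to the attached core and its translate by `θ l`, so each generator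
keeps `x` in one component. `G` is arbitrary in order to serve both for all edges within the core
and for the translates of known edges only. -/
theorem reachable_core (hG : IsGluing T Λ C bar θ o t) (hC : IsCore T Λ C) (hx : x ∈ C)
    {G : SimpleGraph X} (hGinv : ∀ g ∈ gluedSubgroup Λ θ, ∀ a b, G.Adj a b → G.Adj (g • a) (g • b))
    (hGC : T.edgesWithin C ≤ G) (hGt : ∀ l, G.Adj (o l) (t l)) (hy : y ∈ core Λ C θ t) :
    G.Reachable x y := by
  have hC' : ∀ y ∈ C, G.Reachable x y := fun y hy => (hC.connectedOn x hx y hy).mono hGC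
  have ht : ∀ l, G.Reachable x (t l) := fun l => (hC' _ (hG.mem l)).trans (hGt l).reachable
  have hmap : ∀ g ∈ gluedSubgroup Λ θ, ∀ a b, G.Reachable a b → G.Reachable (g • a) (g • b) :=
    fun g hg a b h => Reachable.map (G' := G) ⟨fun z => g • z, fun h => hGinv g hg _ _ h⟩ h
  have hθ : ∀ l, G.Reachable x (θ l • x) := fun l => by
    have h1 := hmap _ (mem_gluedSubgroup Λ θ l) _ _ (ht (bar l))
    rw [hG.smul_eq] at h1
    exact (ht l).trans h1.symm
  have hw : ∀ w ∈ gluedSubgroup Λ θ, G.Reachable x (w • x) := by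
    intro w hw
    induction hw using Subgroup.closure_induction with
    | mem w hw =>
      rcases hw with hw | ⟨l, rfl⟩
      · exact hC' _ (hC.smul_mem w hw x hx)
      · exact hθ l
    | one => rw [one_smul]
    | mul a b ha _ h1 h2 =>
      rw [mul_smul]
      exact h1.trans (hmap a ha _ _ h2)
    | inv a ha h1 =>
      have := hmap _ (inv_mem ha) _ _ h1
      rw [inv_smul_smul] at this
      exact this.symm
  obtain ⟨w, hw', y, hy | ⟨l, rfl⟩, rfl⟩ := hy
  · exact (hw w hw').trans (hmap w hw' _ _ (hC' y hy))
  · exact (hw w hw').trans (hmap w hw' _ _ (ht l))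

theorem isCore [Finite L] (hT : T.IsTree)
    (hact : ∀ (g : Γ) (x y : X), T.Adj x y → T.Adj (g • x) (g • y))
    (hG : IsGluing T Λ C bar θ o t) (hC : IsCore T Λ C) (hx : x ∈ C) :
    IsCore T (gluedSubgroup Λ θ) (core Λ C θ t) := by
  have hinv : ∀ g ∈ gluedSubgroup Λ θ, ∀ x ∈ core Λ C θ t, g • x ∈ core Λ C θ t := by
    rintro g hg _ ⟨w, hw, y, hy, rfl⟩
    exact ⟨g * w, mul_mem hg hw, y, hy, mul_smul _ _ _⟩
  have hsub : C ⊆ core Λ C θ t := fun y hy => ⟨1, one_mem _, y, Or.inl hy, one_smul _ _⟩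
  have ht : ∀ l, t l ∈ core Λ C θ t := fun l => ⟨1, one_mem _, _, Or.inr ⟨l, rfl⟩, one_smul _ _⟩
  obtain ⟨E, hE, hEC⟩ := hC.exists_finite
  refine ⟨hinv, ?_, E ∪ (Set.range fun l => (t l, t l)) ∪ (Set.range fun l => (o l, t l)) ∪
    (Set.range fun l => (t l, o l)), ?_, ?_⟩
  · have h1 : ∀ y ∈ core Λ C θ t, (T.edgesWithin (core Λ C θ t)).Reachable x y := fun y hy =>
      hG.reachable_core hC hx
        (fun g hg a b h => ⟨hact g _ _ h.1, hinv g hg _ h.2.1, hinv g hg _ h.2.2⟩)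
        (edgesWithin_mono hsub) (fun l => ⟨hG.adj l, hsub (hG.mem l), ht l⟩) hy
    exact fun y hy z hz => (h1 y hy).symm.trans (h1 z hz)
  · exact ((hE.union (Set.finite_range _)).union (Set.finite_range _)).union (Set.finite_range _)
  · rintro p hp q hq (rfl | hpq)
    · obtain ⟨w, hw, y, hy | ⟨l, rfl⟩, rfl⟩ := hp
      · obtain ⟨g, hg, e, he, h1, h2⟩ := hEC y hy y hy (Or.inl rfl)
        exact ⟨w * g, mul_mem hw (le_gluedSubgroup _ _ hg), e, Or.inl (Or.inl (Or.inl he)),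
          by rw [mul_smul, h1], by rw [mul_smul, h2]⟩
      · exact ⟨w, hw, _, Or.inl (Or.inl (Or.inr ⟨l, rfl⟩)), rfl, rfl⟩
    -- The translates of edges of `C` and of attaching edges already connect the core, so in a tree
    -- they are all its edges; this bounds the number of edge orbits.
    let R : X → X → Prop := fun a b => ∃ g ∈ gluedSubgroup Λ θ, ∃ y z, g • y = a ∧ g • z = b ∧
      T.Adj y z ∧ ((y ∈ C ∧ z ∈ C) ∨ (∃ l, y = o l ∧ z = t l) ∨ ∃ l, y = t l ∧ z = o l)
    let G : SimpleGraph X :=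
      { Adj := R
        symm := ⟨by
          rintro a b ⟨g, hg, y, z, h1, h2, h3, h4⟩
          refine ⟨g, hg, z, y, h2, h1, h3.symm, ?_⟩
          rcases h4 with h4 | ⟨l, h4⟩ | ⟨l, h4⟩
          exacts [Or.inl h4.symm, Or.inr (Or.inr ⟨l, h4.symm⟩), Or.inr (Or.inl ⟨l, h4.symm⟩)]⟩
        loopless := ⟨by
          rintro a ⟨g, hg, y, z, h1, h2, h3, -⟩
          exact h3.ne (smul_left_cancel g (h1.trans h2.symm))⟩ }
    have hGT : G ≤ T := by
      rintro a b ⟨g, hg, y, z, rfl, rfl, h3, -⟩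
      exact hact g _ _ h3
    have hreach : ∀ y ∈ core Λ C θ t, G.Reachable x y := fun y hy =>
      hG.reachable_core hC hx (G := G)
        (by
          rintro g hg a b ⟨g', hg', y, z, h1, h2, h3⟩
          exact ⟨g * g', mul_mem hg hg', y, z, by rw [mul_smul, h1], by rw [mul_smul, h2], h3⟩)
        (fun a b h => ⟨1, one_mem _, a, b, one_smul _ _, one_smul _ _, h.1, Or.inl h.2⟩)
        (fun l => ⟨1, one_mem _, _, _, one_smul _ _, one_smul _ _, hG.adj l,
          Or.inr (Or.inl ⟨l, rfl, rfl⟩)⟩) hy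
    obtain ⟨w, hw, y, z, rfl, rfl, hyz, h | ⟨l, rfl, rfl⟩ | ⟨l, rfl, rfl⟩⟩ : R p q :=
      hT.adj_of_reachable hGT hpq ((hreach p hp).symm.trans (hreach q hq))
    · obtain ⟨g, hg, e, he, h1, h2⟩ := hEC y h.1 z h.2 (Or.inr hyz)
      exact ⟨w * g, mul_mem hw (le_gluedSubgroup _ _ hg), e, Or.inl (Or.inl (Or.inl he)),
        by rw [mul_smul, h1], by rw [mul_smul, h2]⟩
    · exact ⟨w, hw, _, Or.inl (Or.inr ⟨l, rfl⟩), rfl, rfl⟩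
    · exact ⟨w, hw, _, Or.inr ⟨l, rfl⟩, rfl, rfl⟩

variable {Δ : Set Γ} {κ : Type*} {col : Γ → κ}

/-- Two elements of `Δ` in the same double coset of the glued subgroup have the same colour. -/
theorem col_eq (hT : T.IsTree)
    (hact : ∀ (g : Γ) (x y : X), T.Adj x y → T.Adj (g • x) (g • y))
    (hG : IsGluing T Λ C bar θ o t) (hC : IsCore T Λ C)
    (hmul : ∀ σ ∈ Δ, ∀ g ∈ Λ, ∀ h ∈ Λ, g * σ * h ∈ Δ ∧ col (g * σ * h) = col σ)
    (hinv : ∀ σ ∈ Δ, σ⁻¹ ∈ Δ) (hmeet : ∀ σ ∈ Δ, ∃ c ∈ C, σ • c ∈ C)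
    (hout : ∀ σ ∈ Δ, ∀ l, σ • t l ∉ C)
    (hcol : ∀ σ ∈ Δ, ∀ l l', σ • o l = o l' → σ • t l = t l' →
      (θ l')⁻¹ * σ * θ l ∈ Δ ∧ col ((θ l')⁻¹ * σ * θ l) = col σ)
    {v : Γ} (hv : v ∈ gluedSubgroup Λ θ) {w : Γ} (hw : w ∈ gluedSubgroup Λ θ)
    {σ τ : Γ} (hσ : σ ∈ Δ) (hτ : τ ∈ Δ) (h : σ * v = w * τ) : col σ = col τ := by
  have hunion : ∀ σ ∈ Δ, T.ConnectedOn (C ∪ σ • C) := by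
    intro σ hσ
    obtain ⟨c, hc, hc'⟩ := hmeet σ hσ
    exact hC.connectedOn.union (hC.connectedOn.smul hact σ) hc' (Set.smul_mem_smul_set hc)
  have hout' : ∀ σ ∈ Δ, ∀ l, σ • t l ∉ C ∪ σ • C := by
    rintro σ hσ l (h | h)
    · exact hout σ hσ l h
    · exact hG.notMem l (Set.smul_mem_smul_set_iff.1 h)
  have hout'' : ∀ σ ∈ Δ, ∀ l, t l ∉ C ∪ σ • C := by
    rintro σ hσ l (h | h)
    · exact hG.notMem l h
    · exact hout σ⁻¹ (hinv σ hσ) l (Set.mem_smul_set_iff_inv_smul_mem.1 h)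
  have hin : ∀ σ : Γ, ∀ l, σ • o l ∈ C ∪ σ • C := fun σ l =>
    Or.inr (Set.smul_mem_smul_set (hG.mem l))
  -- `σ v` maps `C` beyond an edge leaving `C ∪ σ C`, hence off `C`, whereas `τ C` meets `C`.
  have hne : ∀ σ ∈ Δ, ∀ τ ∈ Δ, ∀ l v, IsReducedWord Λ bar θ l v → σ * v ≠ τ := by
    intro σ hσ τ hτ l v hv heq
    obtain ⟨c, hc, hc'⟩ := hmeet τ hτ
    rw [← heq, mul_smul] at hc'
    exact hT.notMem_halfTree (hunion σ hσ) (hact σ _ _ (hG.adj l)) (hin σ l) (hout' σ hσ l)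
      (Or.inl hc') (SimpleGraph.smul_mem_halfTree hact σ (hG.reduced_smul_mem hT hact hC hv hc))
  have hbase : ∀ g ∈ Λ, ∀ w ∈ gluedSubgroup Λ θ, ∀ σ ∈ Δ, ∀ τ ∈ Δ, σ * g = w * τ →
      col σ = col τ := by
    intro g hg w hw σ hσ τ hτ h
    rcases hG.mem_or_reduced hw with hw | ⟨k, hk, l, v, hv, rfl⟩
    · have h1 : w⁻¹ * σ * g = τ := by rw [mul_assoc, h, inv_mul_cancel_left]
      rw [← h1, (hmul σ hσ _ (Λ.inv_mem hw) _ hg).2]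
    · refine absurd ?_ (hne _ (hmul _ (hinv σ hσ) _ (Λ.inv_mem hg) _ hk).1 _ (hinv τ hτ) l v hv)
      rw [eq_inv_iff_mul_eq_one]
      have : σ⁻¹ * (k * v * τ) = g := by rw [← h, inv_mul_cancel_left]
      calc g⁻¹ * σ⁻¹ * k * v * τ = g⁻¹ * (σ⁻¹ * (k * v * τ)) := by group
        _ = 1 := by rw [this, inv_mul_cancel]
  -- One letter is peeled off: the assertion for the shorter word `u` is applied to `(θ l')⁻¹ * ρ *
  -- θ l`, where `ρ` is `σ` up to factors from `Λ`.
  have hstep : ∀ l v, IsReducedWord Λ bar θ l v → ∀ u, v = θ l * u →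
      (∀ w ∈ gluedSubgroup Λ θ, ∀ σ ∈ Δ, ∀ τ ∈ Δ, σ * u = w * τ → col σ = col τ) →
      ∀ g ∈ Λ, ∀ w ∈ gluedSubgroup Λ θ, ∀ σ ∈ Δ, ∀ τ ∈ Δ, σ * (g * v) = w * τ →
      col σ = col τ := by
    intro l v hv u hvu hu g hg w hw σ hσ τ hτ h
    rcases hG.mem_or_reduced hw with hw | ⟨k, hk, l', z, hz, rfl⟩
    · refine absurd ?_ (hne _ (hmul σ hσ _ (Λ.inv_mem hw) _ hg).1 τ hτ l v hv)
      rw [mul_assoc, mul_assoc, h, inv_mul_cancel_left]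
    · have hσ' := hmul σ hσ _ (Λ.inv_mem hk) _ hg
      have h1 : k⁻¹ * σ * g * v = z * τ := by
        rw [mul_assoc, mul_assoc, h, mul_assoc, inv_mul_cancel_left]
      rw [← hσ'.2]
      generalize k⁻¹ * σ * g = ρ at hσ' h1
      obtain ⟨c, hc, hc'⟩ := hmeet τ hτ
      have h2 := hG.reduced_smul_mem hT hact hC hz hc'
      have h2' := SimpleGraph.smul_mem_halfTree hact ρ (hG.reduced_smul_mem hT hact hC hv hc)
      rw [← mul_smul, h1, mul_smul] at h2'
      -- The point `ρ v c = z τ c` lies beyond two edges leaving `C ∪ ρ C`, so these edges coincide.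
      obtain ⟨h3, h4⟩ := hT.eq_of_mem_halfTree (hunion ρ hσ'.1) (hin ρ l) (hout' ρ hσ'.1 l)
        (Or.inl (hG.mem l')) (hout'' ρ hσ'.1 l') (hact ρ _ _ (hG.adj l)) (hG.adj l') h2' h2
      obtain ⟨h5, h6⟩ := hcol ρ hσ'.1 l l' h3 h4
      rw [← h6]
      obtain ⟨y, hy, hzy⟩ : ∃ y ∈ gluedSubgroup Λ θ, z = θ l' * y := by
        cases hz with
        | single _ g hg => exact ⟨g, le_gluedSubgroup _ _ hg, rfl⟩
        | cons _ g hg l'' y _ _ =>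
          refine ⟨g * y, ?_, rfl⟩
          have := mul_mem (inv_mem (mem_gluedSubgroup Λ θ l'))
            (mul_mem (inv_mem (le_gluedSubgroup Λ θ hk)) hw)
          simpa using this
      refine hu y hy _ h5 τ hτ ?_
      rw [hvu, hzy] at h1
      calc (θ l')⁻¹ * ρ * θ l * u = (θ l')⁻¹ * (ρ * (θ l * u)) := by group
        _ = y * τ := by rw [h1]; group
  have hred : ∀ l v, IsReducedWord Λ bar θ l v → ∀ g ∈ Λ, ∀ w ∈ gluedSubgroup Λ θ, ∀ σ ∈ Δ,
      ∀ τ ∈ Δ, σ * (g * v) = w * τ → col σ = col τ := by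
    intro l v hv
    induction hv with
    | single l g hg => exact hstep l _ (.single l g hg) g rfl (hbase g hg)
    | cons l g hg l' u hu hne ih => exact hstep l _ (.cons l g hg l' u hu hne) _ rfl (ih g hg)
  rcases hG.mem_or_reduced hv with hv | ⟨g, hg, l, u, hu, rfl⟩
  · exact hbase v hv w hw σ hσ τ hτ h
  · exact hred l u hu g hg w hw σ hσ τ hτ h

end IsGluing

end Gluing

/-! ### Choosing edges in general position by high core-freeness. -/

section Branches

open SimpleGraph

variable {Γ X : Type*} [Group Γ] [MulAction Γ X] {T : SimpleGraph X} {Λ : Subgroup Γ} {C : Set X}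
  {p q x₀ y₀ : X} {Δ : Set Γ}

/-- High core-freeness moves the edge from `x₀` to `y₀` away from finitely many vertices and from
the fixed points of finitely many nontrivial elements. -/
theorem exists_smul_avoiding
    (hcf : ((edgeStabilizer Γ x₀ y₀).subgroupOf (MulAction.stabilizer Γ x₀)).IsHighlyCoreFree)
    {Y : Set X} (hY : Y.Finite) {W : Set Γ} (hW : W.Finite) :
    ∃ h : Γ, h • x₀ = x₀ ∧ h • y₀ ∉ Y ∧
      ∀ w ∈ W, w • x₀ = x₀ → w • h • y₀ = h • y₀ → w = 1 := by
  classical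
  let H := MulAction.stabilizer Γ x₀
  let ν : X → H := fun y => if h : ∃ k : H, k⁻¹ • y₀ = y then h.choose else 1
  have hν : ∀ k : H, (ν (k⁻¹ • y₀))⁻¹ • y₀ = k⁻¹ • y₀ := fun k => by
    have h : ∃ k' : H, k'⁻¹ • y₀ = k⁻¹ • y₀ := ⟨k, rfl⟩
    simp only [ν, dif_pos h]
    exact h.choose_spec
  have hW' : {w : H | (w : Γ) ∈ W}.Finite := hW.preimage Subtype.val_injective.injOn
  -- With `h = g⁻¹`: the first clause, for `1` and `ν y`, keeps `g⁻¹ y₀` off `Y`; the second, for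
  -- `w` and `1`, keeps `w ≠ 1` from fixing `g⁻¹ y₀`.
  obtain ⟨g, hg1, hg2⟩ := hcf ({1} ∪ hW'.toFinset ∪ (hY.image ν).toFinset)
  have hmem : ∀ s : H, s • y₀ = y₀ →
      s ∈ (edgeStabilizer Γ x₀ y₀).subgroupOf (MulAction.stabilizer Γ x₀) := fun s hs =>
    Subgroup.mem_subgroupOf.2 (Subgroup.mem_inf.2 ⟨s.2, hs⟩)
  refine ⟨((g⁻¹ : H) : Γ), (g⁻¹).2, fun hgY => ?_, fun w hw hwx hwy => ?_⟩
  · have h1 : (g * (ν (g⁻¹ • y₀))⁻¹) • y₀ = y₀ := by rw [mul_smul, hν, smul_inv_smul]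
    refine hg1 1 (by simp) (ν (g⁻¹ • y₀)) ?_ _ (hmem _ h1) (by group)
    simp only [Finset.mem_union, Set.Finite.mem_toFinset]
    exact Or.inr ⟨_, hgY, rfl⟩
  · by_contra hne
    let w' : H := ⟨w, hwx⟩
    have hwy' : w' • g⁻¹ • y₀ = g⁻¹ • y₀ := hwy
    have h1 : (g * w' * g⁻¹) • y₀ = y₀ := by
      rw [mul_smul, mul_smul, hwy', smul_inv_smul]
    refine hg2 w' ?_ 1 (by simp) (fun h => hne (congrArg Subtype.val h)) 1 (one_mem _) _
      (hmem _ h1) (by group)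
    simp only [Finset.mem_union, Set.Finite.mem_toFinset]
    exact Or.inl (Or.inr hw)

/-- Only finitely many left cosets of `Λ` matter, and freeness leaves at most one element in each.
-/
theorem IsCore.finite_smul_eq (hC : IsCore T Λ C) (hf : Λ.ActsFreely X) (hT : T.IsTree)
    (hact : ∀ (g : Γ) (x y : X), T.Adj x y → T.Adj (g • x) (g • y))
    (hfin : ∀ x y : X, T.Adj x y → Finite (edgeStabilizer Γ x y))
    (hΔ : Λ.FiniteDouble Δ) (hp : p ∈ C) (hq : q ∈ C) : {σ ∈ Δ | σ • p = q}.Finite := by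
  obtain ⟨M, hM, h⟩ := hC.finite_cosets hf hT hact hfin hΔ hq
  refine (hM.biUnion (t := fun m => {σ | ∃ g ∈ Λ, σ = m * g ∧ σ • p = q}) fun m _ =>
    Set.Subsingleton.finite ?_).subset ?_
  · rintro _ ⟨g, hg, rfl, h1⟩ _ ⟨g', hg', rfl, h2⟩
    rw [mul_smul] at h1 h2
    rw [hf.eq hg hg' (smul_left_cancel m (h1.trans h2.symm))]
  · rintro σ ⟨hσ, rfl⟩
    obtain ⟨m, hm, g, hg, h1⟩ := h σ hσ (Set.smul_mem_smul_set hp)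
    exact Set.mem_biUnion hm ⟨g, hg, h1, rfl⟩

/-- If `z ∉ C` lies in `σ⁻¹ C`, which meets `C`, then so does `p`. Thus `finite_cosets` leaves
finitely many translates, each with finitely many edges at `p`. -/
theorem IsCore.finite_neighbors_smul (hC : IsCore T Λ C) (hf : Λ.ActsFreely X) (hT : T.IsTree)
    (hact : ∀ (g : Γ) (x y : X), T.Adj x y → T.Adj (g • x) (g • y))
    (hfin : ∀ x y : X, T.Adj x y → Finite (edgeStabilizer Γ x y))
    (hΔ : Λ.FiniteDouble Δ) (hinv : ∀ σ ∈ Δ, σ⁻¹ ∈ Δ) (hmeet : ∀ σ ∈ Δ, ∃ c ∈ C, σ • c ∈ C)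
    (hp : p ∈ C) : {z | T.Adj p z ∧ ∃ σ ∈ Δ, σ • z ∈ C}.Finite := by
  obtain ⟨M, hM, h⟩ := hC.finite_cosets hf hT hact hfin hΔ hp
  refine ((hC.finite_neighbors hf p).union (hM.biUnion fun m _ =>
    (hC.finite_neighbors hf (m⁻¹ • p)).image fun z => m • z)).subset ?_
  rintro z ⟨hpz, σ, hσ, hz⟩
  by_cases hzC : z ∈ C
  · exact Or.inl ⟨hp, hzC, hpz⟩
  right
  have hz' : z ∈ σ⁻¹ • C := by rwa [Set.mem_smul_set_iff_inv_smul_mem, inv_inv]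
  have hpσ : p ∈ σ⁻¹ • C := by
    by_contra hn
    obtain ⟨c, hc, hc'⟩ := hmeet _ (hinv σ hσ)
    exact hT.notMem_halfTree hC.connectedOn hpz hp hzC hc' (hT.subset_halfTree
      (hC.connectedOn.smul hact σ⁻¹) hpz hn hz' (Set.smul_mem_smul_set hc))
  obtain ⟨m, hm, g, hg, h1⟩ := h _ (hinv σ hσ) hpσ
  have h2 : ∀ y ∈ σ⁻¹ • C, m⁻¹ • y ∈ C := by
    intro y hy
    rw [Set.mem_smul_set_iff_inv_smul_mem, h1, mul_inv_rev, mul_smul] at hy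
    exact (hC.smul_mem_iff (Λ.inv_mem hg)).1 hy
  exact Set.mem_biUnion hm ⟨m⁻¹ • z, ⟨h2 _ hpσ, h2 _ hz', hact _ _ _ hpz⟩, smul_inv_smul _ _⟩

/-- Hypotheses on a condition under which new branches can be chosen. -/
structure IsTame (T : SimpleGraph X) (Λ : Subgroup Γ) (C : Set X) (Δ : Set Γ) : Prop where
  isCore : IsCore T Λ C
  actsFreely : Λ.ActsFreely X
  le : ∀ g ∈ Λ, g ∈ Δ
  finiteDouble : Λ.FiniteDouble Δ
  inv_mem : ∀ σ ∈ Δ, σ⁻¹ ∈ Δ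
  exists_mem : ∀ σ ∈ Δ, ∃ c ∈ C, σ • c ∈ C

/-- Finitely many directions lead back to the core under `Δ`, and finitely many elements of `Δ`
match the translates of `x₀`; `exists_smul_avoiding` dodges both. -/
theorem IsTame.exists_branch (h : IsTame T Λ C Δ) (hT : T.IsTree)
    (hact : ∀ (g : Γ) (x y : X), T.Adj x y → T.Adj (g • x) (g • y))
    (hfin : ∀ x y : X, T.Adj x y → Finite (edgeStabilizer Γ x y)) (hxy : T.Adj x₀ y₀)
    (hcf : ((edgeStabilizer Γ x₀ y₀).subgroupOf (MulAction.stabilizer Γ x₀)).IsHighlyCoreFree)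
    {ι : Type*} [Finite ι] {c : ι → Γ} (hc : ∀ i, (c i)⁻¹ • x₀ ∈ C) {Y : Set X} (hY : Y.Finite) :
    ∃ u : Γ, u • x₀ = x₀ ∧ u • y₀ ∉ Y ∧ (∀ σ ∈ Δ, ∀ i, σ • (c i)⁻¹ • u • y₀ ∉ C) ∧
      ∀ σ ∈ Δ, ∀ i j, σ • (c i)⁻¹ • x₀ = (c j)⁻¹ • x₀ →
        σ • (c i)⁻¹ • u • y₀ = (c j)⁻¹ • u • y₀ → c j * σ * (c i)⁻¹ = 1 := by
  have hY' : (Y ∪ ⋃ i, (fun z => c i • z) ''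
      {z | T.Adj ((c i)⁻¹ • x₀) z ∧ ∃ σ ∈ Δ, σ • z ∈ C}).Finite :=
    hY.union (Set.finite_iUnion fun i => (h.isCore.finite_neighbors_smul h.actsFreely hT hact hfin
      h.finiteDouble h.inv_mem h.exists_mem (hc i)).image _)
  have hW : (⋃ i, ⋃ j, (fun σ => c j * σ * (c i)⁻¹) ''
      {σ ∈ Δ | σ • (c i)⁻¹ • x₀ = (c j)⁻¹ • x₀}).Finite :=
    Set.finite_iUnion fun i => Set.finite_iUnion fun j => (h.isCore.finite_smul_eq h.actsFreely hT
      hact hfin h.finiteDouble (hc i) (hc j)).image _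
  obtain ⟨u, hu, huY, huW⟩ := exists_smul_avoiding hcf hY' hW
  refine ⟨u, hu, fun hm => huY (Or.inl hm), fun σ hσ i hm => huY (Or.inr ?_), ?_⟩
  · refine Set.mem_iUnion.2 ⟨i, (c i)⁻¹ • u • y₀, ⟨hact _ _ _ ?_, σ, hσ, hm⟩, smul_inv_smul _ _⟩
    have := hact u _ _ hxy
    rwa [hu] at this
  · intro σ hσ i j h1 h2
    refine huW _ (Set.mem_iUnion₂.2 ⟨i, j, σ, ⟨hσ, h1⟩, rfl⟩) ?_ ?_
    · rw [mul_smul, mul_smul, h1, smul_inv_smul]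
    · rw [mul_smul, mul_smul, h2, smul_inv_smul]

/-- Edges `(c l)⁻¹ (x₀, u l y₀)` leaving all translates of the core by `Δ`, such that no element of
`Δ` maps one to another except for the obvious ones on each of the two sides. -/
structure IsBranching (C : Set X) (Δ : Set Γ) (x₀ y₀ : X) {ι ι' : Type*} (c : ι ⊕ ι' → Γ)
    (u : ι ⊕ ι' → Γ) : Prop where
  smul_eq : ∀ l, u l • x₀ = x₀
  notMem : ∀ σ ∈ Δ, ∀ l, σ • (c l)⁻¹ • u l • y₀ ∉ C
  rigid : ∀ σ ∈ Δ, ∀ l l', σ • (c l)⁻¹ • x₀ = (c l')⁻¹ • x₀ →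
    σ • (c l)⁻¹ • u l • y₀ = (c l')⁻¹ • u l' • y₀ →
    l.isLeft = l'.isLeft ∧ c l' * σ * (c l)⁻¹ = 1

/-- With `u` chosen first, `v` must also avoid the finitely many directions that `Δ` could match
with a translate of `u y₀`. -/
theorem IsTame.exists_isBranching (h : IsTame T Λ C Δ) (hT : T.IsTree)
    (hact : ∀ (g : Γ) (x y : X), T.Adj x y → T.Adj (g • x) (g • y))
    (hfin : ∀ x y : X, T.Adj x y → Finite (edgeStabilizer Γ x y)) (hxy : T.Adj x₀ y₀)
    (hcf : ((edgeStabilizer Γ x₀ y₀).subgroupOf (MulAction.stabilizer Γ x₀)).IsHighlyCoreFree)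
    {ι ι' : Type*} [Finite ι] [Finite ι'] {c : ι ⊕ ι' → Γ} (hc : ∀ l, (c l)⁻¹ • x₀ ∈ C) :
    ∃ u v : Γ, u • x₀ = x₀ ∧ v • x₀ = x₀ ∧
      IsBranching C Δ x₀ y₀ c (Sum.elim (fun _ => u) fun _ => v) := by
  obtain ⟨u, hu, -, hu1, hu2⟩ := h.exists_branch hT hact hfin hxy hcf (fun i => hc (.inl i))
    Set.finite_empty
  have hY : (⋃ i, ⋃ j, (fun σ => c (.inr j) • σ⁻¹ • (c (.inl i))⁻¹ • u • y₀) ''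
      {σ ∈ Δ | σ • (c (.inr j))⁻¹ • x₀ = (c (.inl i))⁻¹ • x₀}).Finite :=
    Set.finite_iUnion fun i => Set.finite_iUnion fun j => (h.isCore.finite_smul_eq h.actsFreely hT
      hact hfin h.finiteDouble (hc (.inr j)) (hc (.inl i))).image _
  obtain ⟨v, hv, hvY, hv1, hv2⟩ := h.exists_branch hT hact hfin hxy hcf (fun i => hc (.inr i)) hY
  have hcross : ∀ σ ∈ Δ, ∀ i j, σ • (c (.inr j))⁻¹ • x₀ = (c (.inl i))⁻¹ • x₀ →
      σ • (c (.inr j))⁻¹ • v • y₀ ≠ (c (.inl i))⁻¹ • u • y₀ := by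
    intro σ hσ i j h1 h2
    refine hvY (Set.mem_iUnion₂.2 ⟨i, j, σ, ⟨hσ, h1⟩, ?_⟩)
    change c (.inr j) • σ⁻¹ • (c (.inl i))⁻¹ • u • y₀ = v • y₀
    rw [← h2, inv_smul_smul, smul_inv_smul]
  refine ⟨u, v, hu, hv, ⟨?_, ?_, ?_⟩⟩
  · rintro (i | i)
    exacts [hu, hv]
  · rintro σ hσ (i | i)
    exacts [hu1 σ hσ i, hv1 σ hσ i]
  · rintro σ hσ (i | i) (j | j) h1 h2
    · exact ⟨rfl, hu2 σ hσ i j h1 h2⟩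
    · refine absurd ?_ (hcross σ⁻¹ (h.inv_mem σ hσ) i j (by rw [← h1, inv_smul_smul]))
      rw [inv_smul_eq_iff]
      exact h2.symm
    · exact absurd h2 (hcross σ hσ j i h1)
    · exact ⟨rfl, hv2 σ hσ i j h1 h2⟩

end Branches

/-! ### Finite approximations and deciding double cosets. -/

section Conditions

open SimpleGraph

variable {Γ X : Type*} [Group Γ] [MulAction Γ X] {T : SimpleGraph X} {x₀ y₀ : X}

/-- A group acting on a tree with finite edge stabilizers, with a highly core-free edge stabilizer
at `x₀` and nontrivial at the other end `y₀`. -/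
structure IsAdmissible (Γ : Type*) {X : Type*} [Group Γ] [MulAction Γ X] (T : SimpleGraph X)
    (x₀ y₀ : X) : Prop where
  isTree : T.IsTree
  adj_smul : ∀ (g : Γ) (x y : X), T.Adj x y → T.Adj (g • x) (g • y)
  finite_edgeStabilizer : ∀ x y : X, T.Adj x y → Finite (edgeStabilizer Γ x y)
  adj : T.Adj x₀ y₀
  isHighlyCoreFree :
    ((edgeStabilizer Γ x₀ y₀).subgroupOf (MulAction.stabilizer Γ x₀)).IsHighlyCoreFree
  exists_smul_ne : ∃ k : Γ, k • y₀ = y₀ ∧ k • x₀ ≠ x₀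

/-- A finite approximation of a `Γ`-invariant graph on a quotient of `Γ`: a subgroup `Λ`, and
finitely many double cosets of `Λ` declared to be edges (`P`) or non-edges (`N`). -/
structure Approx (Γ : Type*) {X : Type*} [Group Γ] [MulAction Γ X] (T : SimpleGraph X)
    (x₀ : X) where
  Λ : Subgroup Γ
  P : Set Γ
  N : Set Γ
  actsFreely : Λ.ActsFreely X
  exists_core : ∃ C, IsCore T Λ C ∧ x₀ ∈ C
  mul_P : ∀ σ ∈ P, ∀ g ∈ Λ, ∀ h ∈ Λ, g * σ * h ∈ P
  mul_N : ∀ σ ∈ N, ∀ g ∈ Λ, ∀ h ∈ Λ, g * σ * h ∈ N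
  inv_P : ∀ σ ∈ P, σ⁻¹ ∈ P
  inv_N : ∀ σ ∈ N, σ⁻¹ ∈ N
  one_P : (1 : Γ) ∉ P
  one_N : (1 : Γ) ∉ N
  disj : ∀ σ ∈ P, σ ∉ N
  finiteDouble : Λ.FiniteDouble (P ∪ N)

namespace Approx

instance : Preorder (Approx Γ T x₀) where
  le a b := a.Λ ≤ b.Λ ∧ a.P ⊆ b.P ∧ a.N ⊆ b.N
  le_refl a := ⟨le_rfl, subset_rfl, subset_rfl⟩
  le_trans a b c h h' := ⟨h.1.trans h'.1, h.2.1.trans h'.2.1, h.2.2.trans h'.2.2⟩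

variable (a : Approx Γ T x₀)

/-- The elements whose double coset has been decided. -/
def decided : Set Γ := a.P ∪ a.N ∪ a.Λ

variable {a}

theorem decided_mono {b : Approx Γ T x₀} (h : a ≤ b) : a.decided ⊆ b.decided :=
  Set.union_subset_union (Set.union_subset_union h.2.1 h.2.2) h.1

theorem notMem_P {g : Γ} (hg : g ∈ a.Λ) : g ∉ a.P := fun h =>
  a.one_P (by simpa using a.mul_P g h _ (inv_mem hg) 1 (one_mem _))

theorem notMem_N {g : Γ} (hg : g ∈ a.Λ) : g ∉ a.N := fun h =>
  a.one_N (by simpa using a.mul_N g h _ (inv_mem hg) 1 (one_mem _))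

theorem mul_P_iff {σ g h : Γ} (hg : g ∈ a.Λ) (hh : h ∈ a.Λ) : g * σ * h ∈ a.P ↔ σ ∈ a.P :=
  ⟨fun hs => by simpa [mul_assoc] using a.mul_P _ hs _ (inv_mem hg) _ (inv_mem hh),
    fun hs => a.mul_P σ hs g hg h hh⟩

theorem mul_N_iff {σ g h : Γ} (hg : g ∈ a.Λ) (hh : h ∈ a.Λ) : g * σ * h ∈ a.N ↔ σ ∈ a.N :=
  ⟨fun hs => by simpa [mul_assoc] using a.mul_N _ hs _ (inv_mem hg) _ (inv_mem hh),
    fun hs => a.mul_N σ hs g hg h hh⟩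

theorem mul_Λ_iff {σ g h : Γ} (hg : g ∈ a.Λ) (hh : h ∈ a.Λ) : g * σ * h ∈ a.Λ ↔ σ ∈ a.Λ := by
  rw [Subgroup.mul_mem_cancel_right _ hh, Subgroup.mul_mem_cancel_left _ hg]

theorem mul_decided {σ g h : Γ} (hσ : σ ∈ a.decided) (hg : g ∈ a.Λ) (hh : h ∈ a.Λ) :
    g * σ * h ∈ a.decided := by
  rcases hσ with (hσ | hσ) | hσ
  · exact Or.inl (Or.inl ((mul_P_iff hg hh).2 hσ))
  · exact Or.inl (Or.inr ((mul_N_iff hg hh).2 hσ))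
  · exact Or.inr ((mul_Λ_iff hg hh).2 hσ)

/-- The core is enlarged to contain `d x₀` for every representative `d`; then `σ = g d h` sends `h⁻¹
x₀` into it. -/
theorem exists_isTame (hΓ : IsAdmissible Γ T x₀ y₀) (a : Approx Γ T x₀) {S : Set X}
    (hS : S.Finite) : ∃ C, IsTame T a.Λ C a.decided ∧ x₀ ∈ C ∧ S ⊆ C := by
  obtain ⟨C₀, hC₀, hx₀⟩ := a.exists_core
  obtain ⟨D, hD, h⟩ := a.finiteDouble
  have hD' : ∀ σ ∈ a.decided, ∃ d ∈ D ∪ {1}, ∃ g ∈ a.Λ, ∃ h ∈ a.Λ, σ = g * d * h := by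
    rintro σ (hσ | hσ)
    · obtain ⟨d, hd, h⟩ := h σ hσ
      exact ⟨d, Or.inl hd, h⟩
    · exact ⟨1, Or.inr rfl, σ, hσ, 1, one_mem _, by simp⟩
  obtain ⟨C, hC, hC₀C, hCS⟩ := hC₀.exists_superset hΓ.isTree hΓ.adj_smul hx₀
    (hS.union ((hD.union (Set.finite_singleton 1)).image fun d => d • x₀))
  refine ⟨C, ⟨hC, a.actsFreely, fun g hg => Or.inr hg,
    ⟨_, hD.union (Set.finite_singleton 1), hD'⟩, ?_, ?_⟩, hC₀C hx₀,
    Set.subset_union_left.trans hCS⟩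
  · rintro σ ((hσ | hσ) | hσ)
    · exact Or.inl (Or.inl (a.inv_P σ hσ))
    · exact Or.inl (Or.inr (a.inv_N σ hσ))
    · exact Or.inr (inv_mem hσ)
  · intro σ hσ
    obtain ⟨d, hd, g, hg, h, hh, rfl⟩ := hD' σ hσ
    refine ⟨h⁻¹ • x₀, hC.smul_mem _ (inv_mem hh) _ (hC₀C hx₀), ?_⟩
    rw [mul_smul, mul_smul, smul_inv_smul]
    exact hC.smul_mem _ hg _ (hCS (Or.inr ⟨d, hd, rfl⟩))

/-- The elements of the double cosets of the elements of `S` and of their inverses. -/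
def doubles (Λ : Subgroup Γ) (S : Set Γ) : Set Γ :=
  {σ | ∃ s ∈ S, ∃ g ∈ Λ, ∃ h ∈ Λ, σ = g * s * h ∨ σ = g * s⁻¹ * h}

theorem doubles_mul {Λ : Subgroup Γ} {S : Set Γ} {σ g h : Γ} (hσ : σ ∈ doubles Λ S) (hg : g ∈ Λ)
    (hh : h ∈ Λ) : g * σ * h ∈ doubles Λ S := by
  obtain ⟨s, hs, k, hk, k', hk', rfl | rfl⟩ := hσ
  · exact ⟨s, hs, g * k, mul_mem hg hk, k' * h, mul_mem hk' hh, Or.inl (by group)⟩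
  · exact ⟨s, hs, g * k, mul_mem hg hk, k' * h, mul_mem hk' hh, Or.inr (by group)⟩

theorem doubles_inv {Λ : Subgroup Γ} {S : Set Γ} {σ : Γ} (hσ : σ ∈ doubles Λ S) :
    σ⁻¹ ∈ doubles Λ S := by
  obtain ⟨s, hs, k, hk, k', hk', rfl | rfl⟩ := hσ
  · exact ⟨s, hs, _, inv_mem hk', _, inv_mem hk, Or.inr (by group)⟩
  · exact ⟨s, hs, _, inv_mem hk', _, inv_mem hk, Or.inl (by group)⟩

theorem subset_doubles {Λ : Subgroup Γ} {S : Set Γ} : S ⊆ doubles Λ S := fun s hs =>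
  ⟨s, hs, 1, one_mem _, 1, one_mem _, Or.inl (by simp)⟩

theorem mem_of_doubles {Λ : Subgroup Γ} {S Q : Set Γ}
    (hQ : ∀ σ ∈ Q, ∀ g ∈ Λ, ∀ h ∈ Λ, g * σ * h ∈ Q) (hQi : ∀ σ ∈ Q, σ⁻¹ ∈ Q) {σ : Γ}
    (hσ : σ ∈ doubles Λ S) (hσQ : σ ∈ Q) : ∃ s ∈ S, s ∈ Q := by
  obtain ⟨s, hs, k, hk, m, hm, rfl | rfl⟩ := hσ
  · exact ⟨s, hs, by simpa [mul_assoc] using hQ _ hσQ _ (inv_mem hk) _ (inv_mem hm)⟩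
  · exact ⟨s, hs, by simpa [mul_assoc] using hQi _ (hQ _ hσQ _ (inv_mem hk) _ (inv_mem hm))⟩

/-- Undecided double cosets can be declared to be edges or non-edges. -/
theorem exists_extend (a : Approx Γ T x₀) {A B : Set Γ} (hA : A.Finite) (hB : B.Finite)
    (hAN : ∀ s ∈ A, s ∉ a.N) (hAΛ : ∀ s ∈ A, s ∉ a.Λ) (hBP : ∀ s ∈ B, s ∉ a.P)
    (hBΛ : ∀ s ∈ B, s ∉ a.Λ) (hAB : ∀ s ∈ B, s ∉ doubles a.Λ A) :
    ∃ b, a ≤ b ∧ b.Λ = a.Λ ∧ A ⊆ b.P ∧ B ⊆ b.N := by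
  have hΛ : ∀ σ ∈ (a.Λ : Set Γ), ∀ g ∈ a.Λ, ∀ h ∈ a.Λ, g * σ * h ∈ (a.Λ : Set Γ) :=
    fun σ hσ g hg h hh => mul_mem (mul_mem hg hσ) hh
  have hΛi : ∀ σ ∈ (a.Λ : Set Γ), σ⁻¹ ∈ (a.Λ : Set Γ) := fun σ hσ => inv_mem hσ
  refine ⟨⟨a.Λ, a.P ∪ doubles a.Λ A, a.N ∪ doubles a.Λ B, a.actsFreely, a.exists_core,
    ?_, ?_, ?_, ?_, ?_, ?_, ?_, ?_⟩, ⟨le_rfl, Set.subset_union_left, Set.subset_union_left⟩, rfl,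
    subset_doubles.trans Set.subset_union_right, subset_doubles.trans Set.subset_union_right⟩
  · rintro σ (hσ | hσ) g hg h hh
    exacts [Or.inl (a.mul_P σ hσ g hg h hh), Or.inr (doubles_mul hσ hg hh)]
  · rintro σ (hσ | hσ) g hg h hh
    exacts [Or.inl (a.mul_N σ hσ g hg h hh), Or.inr (doubles_mul hσ hg hh)]
  · rintro σ (hσ | hσ)
    exacts [Or.inl (a.inv_P σ hσ), Or.inr (doubles_inv hσ)]
  · rintro σ (hσ | hσ)
    exacts [Or.inl (a.inv_N σ hσ), Or.inr (doubles_inv hσ)]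
  · rintro (h | h)
    · exact a.one_P h
    · obtain ⟨s, hs, h⟩ := mem_of_doubles hΛ hΛi h (one_mem _)
      exact hAΛ s hs h
  · rintro (h | h)
    · exact a.one_N h
    · obtain ⟨s, hs, h⟩ := mem_of_doubles hΛ hΛi h (one_mem _)
      exact hBΛ s hs h
  · rintro σ (hσ | hσ) (hσ' | hσ')
    · exact a.disj σ hσ hσ'
    · obtain ⟨s, hs, h⟩ := mem_of_doubles a.mul_P a.inv_P hσ' hσ
      exact hBP s hs h
    · obtain ⟨s, hs, h⟩ := mem_of_doubles a.mul_N a.inv_N hσ hσ'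
      exact hAN s hs h
    · obtain ⟨s, hs, h⟩ := mem_of_doubles (fun _ h _ hg _ hh => doubles_mul h hg hh)
        (fun _ h => doubles_inv h) hσ' hσ
      exact hAB s hs h
  · obtain ⟨D, hD, h⟩ := a.finiteDouble
    have hdb : ∀ S : Set Γ, ∀ σ ∈ doubles a.Λ S,
        ∃ d ∈ S ∪ (fun s => s⁻¹) '' S, ∃ g ∈ a.Λ, ∃ h ∈ a.Λ, σ = g * d * h := by
      rintro S σ ⟨s, hs, g, hg, h, hh, rfl | rfl⟩
      · exact ⟨s, Or.inl hs, g, hg, h, hh, rfl⟩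
      · exact ⟨s⁻¹, Or.inr ⟨s, hs, rfl⟩, g, hg, h, hh, rfl⟩
    refine ⟨D ∪ (A ∪ (fun s => s⁻¹) '' A) ∪ (B ∪ (fun s => s⁻¹) '' B),
      (hD.union (hA.union (hA.image _))).union (hB.union (hB.image _)), ?_⟩
    rintro σ ((hσ | hσ) | (hσ | hσ))
    · obtain ⟨d, hd, h⟩ := h σ (Or.inl hσ)
      exact ⟨d, Or.inl (Or.inl hd), h⟩
    · obtain ⟨d, hd, h⟩ := hdb A σ hσ
      exact ⟨d, Or.inl (Or.inr hd), h⟩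
    · obtain ⟨d, hd, h⟩ := h σ (Or.inr hσ)
      exact ⟨d, Or.inl (Or.inl hd), h⟩
    · obtain ⟨d, hd, h⟩ := hdb B σ hσ
      exact ⟨d, Or.inr hd, h⟩

theorem exists_decided (a : Approx Γ T x₀) (g : Γ) :
    ∃ b, a ≤ b ∧ b.Λ = a.Λ ∧ g ∈ b.decided := by
  by_cases hg : g ∈ a.decided
  · exact ⟨a, le_rfl, rfl, hg⟩
  obtain ⟨b, hab, hΛ, -, hb⟩ := a.exists_extend (A := ∅) (B := {g}) Set.finite_empty
    (Set.finite_singleton g) (by simp) (by simp)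
    (by rintro _ rfl h; exact hg (Or.inl (Or.inl h)))
    (by rintro _ rfl h; exact hg (Or.inr h))
    (by rintro _ - ⟨s, hs, -⟩; exact hs)
  exact ⟨b, hab, hΛ, Or.inl (Or.inr (hb rfl))⟩

theorem exists_decided_finite (a : Approx Γ T x₀) {S : Set Γ} (hS : S.Finite) :
    ∃ b, a ≤ b ∧ S ⊆ b.decided := by
  induction S, hS using Set.Finite.induction_on with
  | empty => exact ⟨a, le_rfl, Set.empty_subset _⟩
  | insert _ _ ih =>
    obtain ⟨b, hab, hb⟩ := ih
    obtain ⟨c, hbc, -, hc⟩ := b.exists_decided _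
    exact ⟨c, hab.trans hbc, Set.insert_subset hc (hb.trans (decided_mono hbc))⟩

/-- The trivial approximation. -/
def trivial (Γ : Type*) {X : Type*} [Group Γ] [MulAction Γ X] (T : SimpleGraph X) (x₀ : X) :
    Approx Γ T x₀ where
  Λ := ⊥
  P := ∅
  N := ∅
  actsFreely := fun _ hg _ _ => Subgroup.mem_bot.1 hg
  exists_core := ⟨{x₀}, isCore_singleton_bot x₀, rfl⟩
  mul_P := by simp
  mul_N := by simp
  inv_P := by simp
  inv_N := by simp
  one_P := by simp
  one_N := by simp
  disj := by simp
  finiteDouble := ⟨∅, Set.finite_empty, by simp⟩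

end Approx

end Conditions

/-! ### Density of the extension property and of faithfulness. -/

section Density

open SimpleGraph

variable {Γ X : Type*} [Group Γ] [MulAction Γ X] {T : SimpleGraph X} {x₀ y₀ : X}

/-- The edge from `x₀` to `v y₀` goes to an edge at `u y₀` whose other end is not `x₀`, since `k`
moves `x₀`. -/
theorem IsAdmissible.smul_mem_halfTree (hΓ : IsAdmissible Γ T x₀ y₀) {u v k : Γ} {x : X}
    (hu : u • x₀ = x₀) (hv : v • x₀ = x₀) (hk : k • y₀ = y₀) (hkx : k • x₀ ≠ x₀)
    (hx : x ∉ T.halfTree x₀ (v • y₀)) : (u * k * v⁻¹) • x ∈ T.halfTree x₀ (u • y₀) := by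
  have h1 := SimpleGraph.smul_mem_halfTree hΓ.adj_smul (u * k * v⁻¹)
    ((hΓ.isTree.mem_halfTree_or _ _ x).resolve_left hx)
  have h2 : (u * k * v⁻¹) • v • y₀ = u • y₀ := by rw [mul_smul, inv_smul_smul, mul_smul, hk]
  have h3 : (u * k * v⁻¹) • x₀ = u • k • x₀ := by
    rw [mul_smul, inv_smul_eq_iff.2 hv.symm, mul_smul]
  rw [h2, h3] at h1
  have h4 := hΓ.adj_smul u _ _ hΓ.adj
  have h5 := hΓ.adj_smul u _ _ (hΓ.adj_smul k _ _ hΓ.adj).symm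
  rw [hu] at h4
  rw [hk] at h5
  refine hΓ.isTree.halfTree_subset_halfTree h4 h5 (fun h => hkx ?_) h1
  exact smul_left_cancel u (h.symm.trans hu.symm)

namespace IsBranching

variable {Λ : Subgroup Γ} {C : Set X} {Δ : Set Γ} {ι ι' : Type*} {c u : ι ⊕ ι' → Γ}

theorem adj (hB : IsBranching C Δ x₀ y₀ c u) (hΓ : IsAdmissible Γ T x₀ y₀) (l : ι ⊕ ι') :
    T.Adj ((c l)⁻¹ • x₀) ((c l)⁻¹ • u l • y₀) := by
  have := hΓ.adj_smul (u l) _ _ hΓ.adj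
  rw [hB.smul_eq] at this
  exact hΓ.adj_smul _ _ _ this

theorem notMem_core (hB : IsBranching C Δ x₀ y₀ c u) (hC : IsTame T Λ C Δ) (l : ι ⊕ ι') :
    (c l)⁻¹ • u l • y₀ ∉ C := by
  simpa using hB.notMem 1 (hC.le 1 (one_mem _)) l

theorem notMem_halfTree (hB : IsBranching C Δ x₀ y₀ c u) (hΓ : IsAdmissible Γ T x₀ y₀)
    (hC : IsTame T Λ C Δ) (hc : ∀ l, (c l)⁻¹ • x₀ ∈ C) (l : ι ⊕ ι') {x : X} (hx : x ∈ C) :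
    x ∉ T.halfTree ((c l)⁻¹ • x₀) ((c l)⁻¹ • u l • y₀) :=
  hΓ.isTree.notMem_halfTree hC.isCore.connectedOn (hB.adj hΓ l) (hc l) (hB.notMem_core hC l) hx

/-- Half-trees hanging off the core that meet have the same root edge, to which `rigid` applies. -/
theorem eq_of_mem_halfTree (hB : IsBranching C Δ x₀ y₀ c u) (hΓ : IsAdmissible Γ T x₀ y₀)
    (hC : IsTame T Λ C Δ) (hc : ∀ l, (c l)⁻¹ • x₀ ∈ C) {g : Γ} (hg : g ∈ Λ) {l l' : ι ⊕ ι'} {x : X}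
    (hx : x ∈ T.halfTree ((c l)⁻¹ • x₀) ((c l)⁻¹ • u l • y₀))
    (hx' : g • x ∈ T.halfTree ((c l')⁻¹ • x₀) ((c l')⁻¹ • u l' • y₀)) :
    l.isLeft = l'.isLeft ∧ c l' * g * (c l)⁻¹ = 1 := by
  obtain ⟨h1, h2⟩ := hΓ.isTree.eq_of_mem_halfTree hC.isCore.connectedOn
    (hC.isCore.smul_mem g hg _ (hc l))
    (fun h => hB.notMem_core hC l ((hC.isCore.smul_mem_iff hg).1 h)) (hc l') (hB.notMem_core hC l')
    (hΓ.adj_smul _ _ _ (hB.adj hΓ l)) (hB.adj hΓ l')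
    (SimpleGraph.smul_mem_halfTree hΓ.adj_smul g hx) hx'
  exact hB.rigid g (hC.le g hg) l l' h1 h2

end IsBranching

namespace Approx

/-- The extension property of the random graph can be forced. -/
theorem exists_extension (hΓ : IsAdmissible Γ T x₀ y₀) (a : Approx Γ T x₀) (U W : Finset Γ)
    (hUW : ∀ u ∈ U, ∀ w ∈ W, u⁻¹ * w ∉ a.Λ) :
    ∃ b, a ≤ b ∧ ∃ z : Γ, (∀ u ∈ U, z⁻¹ * u ∈ b.P) ∧ ∀ w ∈ W, z⁻¹ * w ∈ b.N := by
  classical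
  obtain ⟨C, hC, hx₀, hCS⟩ := a.exists_isTame hΓ
    (((U ∪ W).finite_toSet).image fun g => g⁻¹ • x₀)
  -- The half-trees on the left will receive `g⁻¹ z C`; the one on the right, rooted at `x₀`, will
  -- receive `z⁻¹ x₀`.
  let c : ↥(U ∪ W) ⊕ Unit → Γ := Sum.elim (fun g => g) fun _ => 1
  have hc : ∀ l, (c l)⁻¹ • x₀ ∈ C := by
    rintro (g | -)
    · exact hCS ⟨g, g.2, rfl⟩
    · simpa [c] using hx₀
  obtain ⟨u, v, hu, hv, hB⟩ := hC.exists_isBranching hΓ.isTree hΓ.adj_smul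
    hΓ.finite_edgeStabilizer hΓ.adj hΓ.isHighlyCoreFree hc
  obtain ⟨k, hk, hkx⟩ := hΓ.exists_smul_ne
  have hk' : k⁻¹ • y₀ = y₀ := inv_smul_eq_iff.2 hk.symm
  have hkx' : k⁻¹ • x₀ ≠ x₀ := fun h => hkx (inv_smul_eq_iff.1 h).symm
  set z := u * k * v⁻¹ with hz
  have hz' : z⁻¹ = v * k⁻¹ * u⁻¹ := by rw [hz]; group
  have hzC : ∀ x ∈ C, z • x ∈ T.halfTree x₀ (u • y₀) := fun x hx =>
    hΓ.smul_mem_halfTree hu hv hk hkx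
      (by simpa [c] using hB.notMem_halfTree hΓ hC hc (.inr ()) hx)
  have hzC' : ∀ g (hg : g ∈ U ∪ W), ∀ x ∈ C, g⁻¹ • z • x ∈
      T.halfTree ((c (.inl ⟨g, hg⟩))⁻¹ • x₀) ((c (.inl ⟨g, hg⟩))⁻¹ • u • y₀) := fun g hg x hx =>
    SimpleGraph.smul_mem_halfTree hΓ.adj_smul g⁻¹ (hzC x hx)
  -- Were `z⁻¹ g` decided, `g⁻¹ z` would send a point of the core into the core.
  have hund : ∀ g ∈ U ∪ W, z⁻¹ * g ∉ a.decided := by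
    intro g hg h
    obtain ⟨x, hx, hx'⟩ := hC.exists_mem _ (hC.inv_mem _ h)
    rw [mul_inv_rev, inv_inv, mul_smul] at hx'
    exact hB.notMem_halfTree hΓ hC hc _ hx' (hzC' g hg x hx)
  have hAB : ∀ s ∈ (fun g => z⁻¹ * g) '' (W : Set Γ),
      s ∉ doubles a.Λ ((fun g => z⁻¹ * g) '' (U : Set Γ)) := by
    rintro _ ⟨w, hw, rfl⟩ ⟨_, ⟨s, hs, rfl⟩, g, hg, h, hh, heq | heq⟩
    all_goals dsimp only at heq
    -- Same double coset: `h⁻¹` matches the left edges of `s` and `w`, so rigidity gives `s⁻¹ w = h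
    -- ∈ Λ`.
    · have hs' := Finset.mem_union_left W hs
      have hw' := Finset.mem_union_right U hw
      have h1 := hzC' s hs' x₀ hx₀
      have h2 := hzC' w hw' (g • x₀) (hC.isCore.smul_mem g hg _ hx₀)
      have h3 : w⁻¹ • z • g • x₀ = h⁻¹ • s⁻¹ • z • x₀ := by
        have : w⁻¹ * z = h⁻¹ * (s⁻¹ * z) * g⁻¹ := by
          rw [← inv_inj, mul_inv_rev, inv_inv, heq]; group
        rw [smul_smul, this]
        simp only [smul_smul]
        congr 1
        group
      rw [h3] at h2
      have h4 := (hB.eq_of_mem_halfTree hΓ hC hc (inv_mem hh) h1 h2).2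
      have h5 : w * h⁻¹ * s⁻¹ = 1 := h4
      refine hUW s hs w hw ?_
      have : s⁻¹ * w = h := by
        rw [mul_inv_eq_one, mul_inv_eq_iff_eq_mul] at h5
        rw [h5, inv_mul_cancel_left]
      rwa [this]
    -- Inverse double coset: `g` would match a left edge with the right one.
    · have hs' := Finset.mem_union_left W hs
      have hw' := Finset.mem_union_right U hw
      have hwC : w⁻¹ • x₀ ∈ C := hc (.inl ⟨w, hw'⟩)
      have h1 := hzC' s hs' _ (hC.isCore.smul_mem h hh _ hwC)
      have hx₀u : x₀ ∉ T.halfTree x₀ (u • y₀) := by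
        have := hΓ.adj_smul u _ _ hΓ.adj
        rw [hu] at this
        exact hΓ.isTree.notMem_halfTree_self this
      have h2 : z⁻¹ • x₀ ∈ T.halfTree ((c (.inr ()))⁻¹ • x₀) ((c (.inr ()))⁻¹ • v • y₀) := by
        simpa [c, hz'] using hΓ.smul_mem_halfTree hv hu hk' hkx' hx₀u
      have h3 : z⁻¹ • x₀ = g • s⁻¹ • z • h • w⁻¹ • x₀ := by
        have : z⁻¹ = g * s⁻¹ * z * h * w⁻¹ := by
          rw [eq_mul_inv_iff_mul_eq, heq]; group
        rw [this]
        simp only [smul_smul, mul_assoc]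
      rw [h3] at h2
      have h4 := (hB.eq_of_mem_halfTree hΓ hC hc hg h1 h2).1
      simp at h4
  obtain ⟨b, hab, -, hP, hN⟩ := a.exists_extend (A := (fun g => z⁻¹ * g) '' U)
    (B := (fun g => z⁻¹ * g) '' W) (U.finite_toSet.image _) (W.finite_toSet.image _)
    (by
      rintro _ ⟨g, hg, rfl⟩ h
      exact hund g (Finset.mem_union_left _ hg) (Or.inl (Or.inr h)))
    (by
      rintro _ ⟨g, hg, rfl⟩ h
      exact hund g (Finset.mem_union_left _ hg) (Or.inr h))
    (by
      rintro _ ⟨g, hg, rfl⟩ h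
      exact hund g (Finset.mem_union_right _ hg) (Or.inl (Or.inl h)))
    (by
      rintro _ ⟨g, hg, rfl⟩ h
      exact hund g (Finset.mem_union_right _ hg) (Or.inr h)) hAB
  exact ⟨b, hab, z, fun g hg => hP ⟨g, hg, rfl⟩, fun g hg => hN ⟨g, hg, rfl⟩⟩

/-- Nontrivial elements can be forced to act nontrivially. -/
theorem exists_conj_notMem (hΓ : IsAdmissible Γ T x₀ y₀) (a : Approx Γ T x₀) {g : Γ}
    (hg : g ≠ 1) : ∃ b, a ≤ b ∧ ∃ z : Γ, z⁻¹ * g * z ∈ b.P ∪ b.N := by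
  obtain ⟨z, hz⟩ : ∃ z : Γ, z⁻¹ * g * z ∉ a.Λ := by
    -- If all conjugates of `g` lie in `Λ`, take `z` folding `C` into a half-tree off the core: it
    -- contains both `z x₀` and `g z x₀`, so rigidity forces `g = 1`.
    by_contra! hcon
    have hgΛ : g ∈ a.Λ := by simpa using hcon 1
    obtain ⟨C, hC, hx₀, -⟩ := a.exists_isTame hΓ Set.finite_empty
    obtain ⟨c, hc₁⟩ : ∃ c : Unit ⊕ Unit → Γ, ∀ l, c l = 1 := ⟨fun _ => 1, fun _ => rfl⟩
    have hc : ∀ l, (c l)⁻¹ • x₀ ∈ C := fun l => by simpa [hc₁] using hx₀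
    obtain ⟨u, v, hu, hv, hB⟩ := hC.exists_isBranching hΓ.isTree hΓ.adj_smul
      hΓ.finite_edgeStabilizer hΓ.adj hΓ.isHighlyCoreFree hc
    obtain ⟨k, hk, hkx⟩ := hΓ.exists_smul_ne
    have hzC : ∀ x ∈ C, (u * k * v⁻¹) • x ∈
        T.halfTree ((c (.inl ()))⁻¹ • x₀) ((c (.inl ()))⁻¹ • u • y₀) := fun x hx => by
      simpa [hc₁] using hΓ.smul_mem_halfTree hu hv hk hkx
        (by simpa [hc₁] using hB.notMem_halfTree hΓ hC hc (.inr ()) hx)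
    generalize u * k * v⁻¹ = z at hzC
    have h1 := hzC x₀ hx₀
    have h2 := hzC _ (hC.isCore.smul_mem _ (hcon z) _ hx₀)
    have h3 : z • (z⁻¹ * g * z) • x₀ = g • z • x₀ := by simp [smul_smul, mul_assoc]
    rw [h3] at h2
    have h4 := (hB.eq_of_mem_halfTree hΓ hC hc hgΛ (l := .inl ()) (l' := .inl ()) h1 h2).2
    exact hg (by simpa [hc₁] using h4)
  obtain ⟨b, hab, hΛ, hb | hb⟩ := a.exists_decided (z⁻¹ * g * z)
  · exact ⟨b, hab, z, hb⟩
  · have hb' : z⁻¹ * g * z ∈ b.Λ := hb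
    rw [hΛ] at hb'
    exact absurd hb' hz

end Approx

end Density

/-! ### Density of realizing finite partial isomorphisms. -/

section Realize

open SimpleGraph

variable {Γ X : Type*} [Group Γ] [MulAction Γ X] {T : SimpleGraph X} {x₀ y₀ : X}

namespace IsBranching

variable {Λ : Subgroup Γ} {C : Set X} {Δ : Set Γ} {ι : Type*} {c : ι ⊕ ι → Γ} {u v : Γ}

/-- The letters `(c l)⁻¹ u k v⁻¹ c (swap l)` attached to a branching. -/
def letter (c : ι ⊕ ι → Γ) (u v k : Γ) : ι ⊕ ι → Γ
  | .inl i => (c (.inl i))⁻¹ * (u * k⁻¹ * v⁻¹) * c (.inr i)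
  | .inr i => (c (.inr i))⁻¹ * (v * k * u⁻¹) * c (.inl i)

/-- For `free`: by rigidity an element of `Λ` matching two attaching edges is `(c l')⁻¹ c l`, and
the indices on each side are distinct modulo `Λ`. The field `smul_ne` is where `k x₀ ≠ x₀` enters.
-/
theorem isGluing (hB : IsBranching C Δ x₀ y₀ c (Sum.elim (fun _ => u) fun _ => v))
    (hΓ : IsAdmissible Γ T x₀ y₀) (hC : IsTame T Λ C Δ) (hc : ∀ l, (c l)⁻¹ • x₀ ∈ C)
    (hinl : ∀ i j, (c (.inl i))⁻¹ * c (.inl j) ∈ Λ → i = j)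
    (hinr : ∀ i j, (c (.inr i))⁻¹ * c (.inr j) ∈ Λ → i = j) {k : Γ} (hk : k • y₀ = y₀)
    (hkx : k • x₀ ≠ x₀) :
    IsGluing T Λ C Sum.swap (letter c u v k) (fun l => (c l)⁻¹ • x₀)
      (fun l => (c l)⁻¹ • (Sum.elim (fun _ => u) (fun _ => v) l : Γ) • y₀) := by
  have hk' : k⁻¹ • y₀ = y₀ := inv_smul_eq_iff.2 hk.symm
  have hkx' : k⁻¹ • x₀ ≠ x₀ := fun h => hkx (inv_smul_eq_iff.1 h).symm
  refine ⟨Sum.swap_swap, ?_, ?_, hc, hB.notMem_core hC, hB.adj hΓ, ?_, ?_, ?_⟩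
  · rintro (i | i) <;> simp
  · rintro (i | i) <;> simp [letter, mul_assoc]
  · rintro (i | i) <;> simp [letter, mul_smul, hk, hk']
  · rintro (i | i) h
    · have hu : u • x₀ = x₀ := hB.smul_eq (.inl i)
      have hv : v⁻¹ • x₀ = x₀ := inv_smul_eq_iff.2 (hB.smul_eq (.inr i)).symm
      simp only [letter, Sum.swap_inl, mul_smul, smul_inv_smul, hv, smul_left_cancel_iff] at h
      exact hkx' (smul_left_cancel u (h.trans hu.symm))
    · have hu : u⁻¹ • x₀ = x₀ := inv_smul_eq_iff.2 (hB.smul_eq (.inl i)).symm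
      have hv : v • x₀ = x₀ := hB.smul_eq (.inr i)
      simp only [letter, Sum.swap_inr, mul_smul, smul_inv_smul, hu, smul_left_cancel_iff] at h
      exact hkx (smul_left_cancel v (h.trans hv.symm))
  · intro g hg l l' h
    have h1 : g • (c l)⁻¹ • x₀ = (c l')⁻¹ • x₀ := by
      have h2 := hΓ.adj_smul g _ _ (hB.adj hΓ l)
      rw [h] at h2
      exact hΓ.isTree.eq_of_adj_of_adj hC.isCore.connectedOn (hC.isCore.smul_mem g hg _ (hc l))
        (hc l') (hB.notMem_core hC l') h2 (hB.adj hΓ l')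
    obtain ⟨h2, h3⟩ := hB.rigid g (hC.le g hg) l l' h1 h
    have h4 : (c l')⁻¹ * c l = g := by
      rw [mul_inv_eq_one] at h3
      rw [← h3, inv_mul_cancel_left]
    have h5 : l' = l := by
      rcases l with i | i <;> rcases l' with j | j
      · exact congrArg _ (hinl j i (h4 ▸ hg))
      · simp at h2
      · simp at h2
      · exact congrArg _ (hinr j i (h4 ▸ hg))
    rw [h5, inv_mul_cancel] at h4
    exact ⟨h4.symm, h5.symm⟩

end IsBranching

namespace Approx

/-- A finite partial isomorphism whose adjacencies have been decided can be realized. -/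
theorem exists_realize_of_decided (hΓ : IsAdmissible Γ T x₀ y₀) (a : Approx Γ T x₀)
    {ι : Type*} [Finite ι] (s t : ι → Γ) (hs : ∀ i j, (s i)⁻¹ * s j ∈ a.Λ → i = j)
    (ht : ∀ i j, (t i)⁻¹ * t j ∈ a.Λ → i = j)
    (hsd : ∀ i j, (s i)⁻¹ * s j ∈ a.decided) (htd : ∀ i j, (t i)⁻¹ * t j ∈ a.decided)
    (hP : ∀ i j, (s i)⁻¹ * s j ∈ a.P ↔ (t i)⁻¹ * t j ∈ a.P)
    (hN : ∀ i j, (s i)⁻¹ * s j ∈ a.N ↔ (t i)⁻¹ * t j ∈ a.N) :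
    ∃ b, a ≤ b ∧ ∃ g : Γ, ∀ i, (t i)⁻¹ * g * s i ∈ b.Λ := by
  obtain ⟨C, hC, hx₀, hCS⟩ := a.exists_isTame hΓ
    ((Set.finite_range fun i => (s i)⁻¹ • x₀).union (Set.finite_range fun i => (t i)⁻¹ • x₀))
  let c : ι ⊕ ι → Γ := Sum.elim s t
  have hc : ∀ l, (c l)⁻¹ • x₀ ∈ C := by
    rintro (i | i)
    · exact hCS (Or.inl ⟨i, rfl⟩)
    · exact hCS (Or.inr ⟨i, rfl⟩)
  obtain ⟨u, v, hu, hv, hB⟩ := hC.exists_isBranching hΓ.isTree hΓ.adj_smul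
    hΓ.finite_edgeStabilizer hΓ.adj hΓ.isHighlyCoreFree hc
  obtain ⟨k, hk, hkx⟩ := hΓ.exists_smul_ne
  have hG := hB.isGluing hΓ hC hc hs ht hk hkx
  set θ := IsBranching.letter c u v k with hθ
  let col : Γ → Prop × Prop := fun σ => (σ ∈ a.P, σ ∈ a.N)
  have hcol : ∀ σ ∈ a.decided, ∀ τ ∈ a.decided, ∀ v ∈ gluedSubgroup a.Λ θ,
      ∀ w ∈ gluedSubgroup a.Λ θ, σ * v = w * τ → col σ = col τ := by
    intro σ hσ τ hτ v' hv' w hw h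
    refine hG.col_eq hΓ.isTree hΓ.adj_smul hC.isCore ?_ hC.inv_mem hC.exists_mem hB.notMem ?_ hv' hw
      hσ hτ h
    · intro σ hσ g hg h hh
      exact ⟨mul_decided hσ hg hh, by simp only [col, mul_P_iff hg hh, mul_N_iff hg hh]⟩
    · intro σ hσ l l' h1 h2
      obtain ⟨h3, h4⟩ := hB.rigid σ hσ l l' h1 h2
      -- So `σ` is `(s j)⁻¹ s i` or `(t j)⁻¹ t i`; multiplying by the letters exchanges the two,
      -- whose colours agree by `hP` and `hN`.
      have h5 : σ = (c l')⁻¹ * c l := by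
        rw [mul_inv_eq_one] at h4
        rw [← h4, inv_mul_cancel_left]
      rw [h5]
      rcases l with i | i <;> rcases l' with j | j
      · have h6 : (θ (.inl j))⁻¹ * ((c (.inl j))⁻¹ * c (.inl i)) * θ (.inl i) =
            (t j)⁻¹ * t i := by
          simp only [hθ, IsBranching.letter, c, Sum.elim_inl, Sum.elim_inr]
          group
        rw [h6]
        exact ⟨htd j i, by simp only [col, c, Sum.elim_inl, hP, hN]⟩
      · simp at h3
      · simp at h3
      · have h6 : (θ (.inr j))⁻¹ * ((c (.inr j))⁻¹ * c (.inr i)) * θ (.inr i) =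
            (s j)⁻¹ * s i := by
          simp only [hθ, IsBranching.letter, c, Sum.elim_inl, Sum.elim_inr]
          group
        rw [h6]
        exact ⟨hsd j i, by simp only [col, c, Sum.elim_inr, hP, hN]⟩
  have hcore := hG.isCore hΓ.isTree hΓ.adj_smul hC.isCore hx₀
  have hPd : ∀ σ ∈ a.P, σ ∈ a.decided := fun σ h => Or.inl (Or.inl h)
  have hNd : ∀ σ ∈ a.N, σ ∈ a.decided := fun σ h => Or.inl (Or.inr h)
  have h1d : (1 : Γ) ∈ a.decided := Or.inr (one_mem _)
  let M := gluedSubgroup a.Λ θ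
  -- The old double cosets are saturated under the larger group; `hcol` keeps edges, non-edges and
  -- `1` apart.
  let sat : Set Γ → Set Γ := fun Q => {w | ∃ σ ∈ Q, ∃ g ∈ M, ∃ h ∈ M, w = g * σ * h}
  have hsat : ∀ Q, Q ⊆ sat Q := fun Q σ hσ => ⟨σ, hσ, 1, one_mem _, 1, one_mem _, by simp⟩
  have hsatmul : ∀ Q, ∀ σ ∈ sat Q, ∀ g ∈ M, ∀ h ∈ M, g * σ * h ∈ sat Q := by
    rintro Q _ ⟨σ, hσ, g, hg, h, hh, rfl⟩ g' hg' h' hh'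
    exact ⟨σ, hσ, g' * g, mul_mem hg' hg, h * h', mul_mem hh hh', by group⟩
  have hsatinv : ∀ Q : Set Γ, (∀ σ ∈ Q, σ⁻¹ ∈ Q) → ∀ σ ∈ sat Q, σ⁻¹ ∈ sat Q := by
    rintro Q hQ _ ⟨σ, hσ, g, hg, h, hh, rfl⟩
    exact ⟨σ⁻¹, hQ σ hσ, h⁻¹, inv_mem hh, g⁻¹, inv_mem hg, by group⟩
  have hsatone : ∀ Q : Set Γ, (∀ σ ∈ Q, σ ∈ a.decided) → (1 : Γ) ∈ sat Q →
      ∃ σ ∈ Q, col σ = col 1 := by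
    rintro Q hQ ⟨σ, hσ, g, hg, h, hh, h1⟩
    refine ⟨σ, hσ, hcol σ (hQ σ hσ) 1 h1d h hh g⁻¹ (inv_mem hg) ?_⟩
    rw [mul_one, eq_inv_iff_mul_eq_one, mul_eq_one_iff_eq_inv]
    rw [mul_assoc] at h1
    exact eq_inv_of_mul_eq_one_right h1.symm
  let b : Approx Γ T x₀ :=
    { Λ := M
      P := sat a.P
      N := sat a.N
      actsFreely := hG.actsFreely hΓ.isTree hΓ.adj_smul hC.isCore hC.actsFreely
        hcore.connectedOn hx₀
      exists_core := ⟨_, hcore, 1, one_mem _, x₀, Or.inl hx₀, one_smul _ _⟩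
      mul_P := hsatmul a.P
      mul_N := hsatmul a.N
      inv_P := hsatinv _ a.inv_P
      inv_N := hsatinv _ a.inv_N
      one_P := fun h => by
        obtain ⟨σ, hσ, h1⟩ := hsatone _ hPd h
        have h2 : (σ ∈ a.P) = (1 ∈ a.P) := congrArg Prod.fst h1
        exact a.one_P (h2 ▸ hσ)
      one_N := fun h => by
        obtain ⟨σ, hσ, h1⟩ := hsatone _ hNd h
        have h2 : (σ ∈ a.N) = (1 ∈ a.N) := congrArg Prod.snd h1
        exact a.one_N (h2 ▸ hσ)
      disj := by
        rintro _ ⟨σ, hσ, g, hg, h, hh, rfl⟩ ⟨τ, hτ, g', hg', h', hh', heq⟩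
        have h1 := hcol σ (hPd σ hσ) τ (hNd τ hτ) (h * h'⁻¹) (mul_mem hh (inv_mem hh'))
          (g⁻¹ * g') (mul_mem (inv_mem hg) hg') (by
            rw [← mul_assoc, mul_inv_eq_iff_eq_mul, mul_assoc g⁻¹, mul_assoc g⁻¹, ← heq]
            group)
        have h2 : (σ ∈ a.P) = (τ ∈ a.P) := congrArg Prod.fst h1
        exact a.disj τ (h2 ▸ hσ) hτ
      finiteDouble := by
        obtain ⟨D, hD, hDP⟩ := a.finiteDouble
        have hle : a.Λ ≤ M := le_gluedSubgroup _ _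
        refine ⟨D, hD, ?_⟩
        have key : ∀ σ ∈ a.P ∪ a.N, ∀ g ∈ M, ∀ h ∈ M,
            ∃ d ∈ D, ∃ g' ∈ M, ∃ h' ∈ M, g * σ * h = g' * d * h' := by
          intro σ hσ g hg h hh
          obtain ⟨d, hd, g', hg', h', hh', rfl⟩ := hDP σ hσ
          exact ⟨d, hd, g * g', mul_mem hg (hle hg'), h' * h, mul_mem (hle hh') hh, by group⟩
        rintro _ (⟨σ, hσ, g, hg, h, hh, rfl⟩ | ⟨σ, hσ, g, hg, h, hh, rfl⟩)
        · exact key σ (Or.inl hσ) g hg h hh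
        · exact key σ (Or.inr hσ) g hg h hh }
  -- The letter of index `inr i` is `(t i)⁻¹ (v k u⁻¹) s i`, so a single `g` serves all `i`.
  refine ⟨b, ⟨le_gluedSubgroup _ _, hsat _, hsat _⟩, v * k * u⁻¹, fun i => ?_⟩
  exact mem_gluedSubgroup a.Λ θ (.inr i)

/-- A finite partial map can be forced to be realized or to be no partial isomorphism. -/
theorem exists_realize (hΓ : IsAdmissible Γ T x₀ y₀) (a : Approx Γ T x₀) (S : Finset (Γ × Γ)) :
    ∃ b, a ≤ b ∧
      ((∃ p ∈ S, ∃ q ∈ S, p ≠ q ∧ (p.1⁻¹ * q.1 ∈ b.Λ ∨ p.2⁻¹ * q.2 ∈ b.Λ)) ∨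
      (∃ p ∈ S, ∃ q ∈ S, (p.1⁻¹ * q.1 ∈ b.P ∧ p.2⁻¹ * q.2 ∈ b.N) ∨
        (p.1⁻¹ * q.1 ∈ b.N ∧ p.2⁻¹ * q.2 ∈ b.P)) ∨
      ∃ g : Γ, ∀ p ∈ S, p.2⁻¹ * g * p.1 ∈ b.Λ) := by
  -- Once every relevant double coset is decided, either the map fails to be a partial isomorphism,
  -- and does so in all extensions, or its colours match.
  obtain ⟨b, hab, hb⟩ := a.exists_decided_finite
    ((Set.finite_range fun p : S × S => p.1.1.1⁻¹ * p.2.1.1).union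
      (Set.finite_range fun p : S × S => p.1.1.2⁻¹ * p.2.1.2))
  have hd₁ : ∀ p q : S, p.1.1⁻¹ * q.1.1 ∈ b.decided := fun p q => hb (Or.inl ⟨(p, q), rfl⟩)
  have hd₂ : ∀ p q : S, p.1.2⁻¹ * q.1.2 ∈ b.decided := fun p q => hb (Or.inr ⟨(p, q), rfl⟩)
  by_cases h1 : ∃ p ∈ S, ∃ q ∈ S, p ≠ q ∧ (p.1⁻¹ * q.1 ∈ b.Λ ∨ p.2⁻¹ * q.2 ∈ b.Λ)
  · exact ⟨b, hab, Or.inl h1⟩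
  by_cases h2 : ∃ p ∈ S, ∃ q ∈ S, (p.1⁻¹ * q.1 ∈ b.P ∧ p.2⁻¹ * q.2 ∈ b.N) ∨
      (p.1⁻¹ * q.1 ∈ b.N ∧ p.2⁻¹ * q.2 ∈ b.P)
  · exact ⟨b, hab, Or.inr (Or.inl h2)⟩
  push Not at h1 h2
  have hΛ : ∀ p q : S, p.1.1⁻¹ * q.1.1 ∈ b.Λ ↔ p.1.2⁻¹ * q.1.2 ∈ b.Λ := by
    intro p q
    by_cases hpq : p = q
    · simp [hpq]
    · have := h1 p.1 p.2 q.1 q.2 fun h => hpq (Subtype.ext h)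
      simp [this]
  have hboth : ∀ p q : S, (p.1.1⁻¹ * q.1.1 ∈ b.P ↔ p.1.2⁻¹ * q.1.2 ∈ b.P) ∧
      (p.1.1⁻¹ * q.1.1 ∈ b.N ↔ p.1.2⁻¹ * q.1.2 ∈ b.N) := by
    intro p q
    have h3 := h2 p.1 p.2 q.1 q.2
    have h4 := hΛ p q
    rcases hd₁ p q with (h5 | h5) | h5 <;> rcases hd₂ p q with (h6 | h6) | h6
    · exact ⟨iff_of_true h5 h6, iff_of_false (b.disj _ h5) (b.disj _ h6)⟩
    · exact absurd h6 (h3.1 h5)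
    · exact absurd h5 (notMem_P (h4.2 h6))
    · exact absurd h6 (h3.2 h5)
    · exact ⟨iff_of_false (fun h => b.disj _ h h5) (fun h => b.disj _ h h6), iff_of_true h5 h6⟩
    · exact absurd h5 (notMem_N (h4.2 h6))
    · exact absurd h6 (notMem_P (h4.1 h5))
    · exact absurd h6 (notMem_N (h4.1 h5))
    · exact ⟨iff_of_false (notMem_P h5) (notMem_P h6), iff_of_false (notMem_N h5) (notMem_N h6)⟩
  obtain ⟨d, hbd, g, hg⟩ := b.exists_realize_of_decided hΓ (fun p : S => p.1.1) (fun p : S => p.1.2)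
    (fun p q h => by
      by_contra hne
      exact (h1 p.1 p.2 q.1 q.2 fun h => hne (Subtype.ext h)).1 h)
    (fun p q h => by
      by_contra hne
      exact (h1 p.1 p.2 q.1 q.2 fun h => hne (Subtype.ext h)).2 h)
    hd₁ hd₂ (fun p q => (hboth p q).1) (fun p q => (hboth p q).2)
  exact ⟨d, hab.trans hbd, Or.inr (Or.inr ⟨g, fun p hp => hg ⟨p, hp⟩⟩)⟩

end Approx

end Realize

/-! ### Uniqueness of the random graph by back-and-forth. -/

section RandomGraph

variable {V W : Type*} {R : SimpleGraph V} {S : SimpleGraph W}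

/-- A finite set of pairs is the graph of an isomorphism between finite induced subgraphs. -/
def IsPartialIso (R : SimpleGraph V) (S : SimpleGraph W) (f : Finset (V × W)) : Prop :=
  ∀ p ∈ f, ∀ q ∈ f, (p.1 = q.1 ↔ p.2 = q.2) ∧ (R.Adj p.1 q.1 ↔ S.Adj p.2 q.2)

/-- The new image is adjacent exactly to the images of the neighbours of `a`, and differs from all
earlier images. -/
theorem IsPartialIso.exists_extend_left (hS : IsRandomGraph S) {f : Finset (V × W)}
    (hf : IsPartialIso R S f) (a : V) :
    ∃ f', IsPartialIso R S f' ∧ f ⊆ f' ∧ ∃ b, (a, b) ∈ f' := by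
  classical
  by_cases ha : ∃ b, (a, b) ∈ f
  · exact ⟨f, hf, subset_rfl, ha⟩
  obtain ⟨z, hzU, hzW, hU, hW⟩ := hS.exists_adj ((f.filter fun p => R.Adj a p.1).image Prod.snd)
    ((f.filter fun p => ¬ R.Adj a p.1).image Prod.snd) (by
      rw [Finset.disjoint_left]
      simp only [Finset.mem_image, Finset.mem_filter]
      rintro _ ⟨p, ⟨hp, hpa⟩, rfl⟩ ⟨q, ⟨hq, hqa⟩, hqp⟩
      rw [(hf q hq p hp).1.2 hqp] at hqa
      exact hqa hpa)
  have hadj : ∀ p ∈ f, R.Adj a p.1 ↔ S.Adj z p.2 := fun p hp => by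
    by_cases h : R.Adj a p.1
    · exact iff_of_true h (hU _ (Finset.mem_image_of_mem _ (Finset.mem_filter.2 ⟨hp, h⟩)))
    · exact iff_of_false h (hW _ (Finset.mem_image_of_mem _ (Finset.mem_filter.2 ⟨hp, h⟩)))
  have hz : ∀ p ∈ f, z ≠ p.2 := fun p hp h => by
    by_cases h' : R.Adj a p.1
    · exact hzU (h ▸ Finset.mem_image_of_mem _ (Finset.mem_filter.2 ⟨hp, h'⟩))
    · exact hzW (h ▸ Finset.mem_image_of_mem _ (Finset.mem_filter.2 ⟨hp, h'⟩))
  have ha' : ∀ p ∈ f, a ≠ p.1 := fun p hp h => ha ⟨p.2, h ▸ hp⟩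
  refine ⟨insert (a, z) f, ?_, Finset.subset_insert _ _, z, Finset.mem_insert_self _ _⟩
  intro p hp q hq
  rcases Finset.mem_insert.1 hp with rfl | hp <;> rcases Finset.mem_insert.1 hq with rfl | hq
  · simp
  · exact ⟨iff_of_false (ha' q hq) (hz q hq), hadj q hq⟩
  · exact ⟨iff_of_false (ha' p hp).symm (hz p hp).symm, by
      rw [R.adj_comm, S.adj_comm]; exact hadj p hp⟩
  · exact hf p hp q hq

theorem IsPartialIso.map_swap {f : Finset (V × W)} (hf : IsPartialIso R S f) :
    IsPartialIso S R (f.map (Equiv.prodComm V W).toEmbedding) := by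
  intro p hp q hq
  obtain ⟨p, hp', rfl⟩ := Finset.mem_map.1 hp
  obtain ⟨q, hq', rfl⟩ := Finset.mem_map.1 hq
  exact ⟨(hf p hp' q hq').1.symm, (hf p hp' q hq').2.symm⟩

theorem IsPartialIso.exists_extend_right (hR : IsRandomGraph R) {f : Finset (V × W)}
    (hf : IsPartialIso R S f) (b : W) :
    ∃ f', IsPartialIso R S f' ∧ f ⊆ f' ∧ ∃ a, (a, b) ∈ f' := by
  obtain ⟨f', hf', hsub, a, ha⟩ := hf.map_swap.exists_extend_left hR b
  refine ⟨f'.map (Equiv.prodComm W V).toEmbedding, hf'.map_swap, fun p hp => ?_, a,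
    Finset.mem_map.2 ⟨_, ha, rfl⟩⟩
  exact Finset.mem_map.2 ⟨p.swap, hsub (Finset.mem_map.2 ⟨p, hp, rfl⟩), rfl⟩

/-- Any two random graphs are isomorphic. -/
theorem IsRandomGraph.nonempty_iso (hR : IsRandomGraph R) (hS : IsRandomGraph S) :
    Nonempty (R ≃g S) := by
  have := hR.countable
  have := hS.countable
  let := Encodable.ofCountable (V ⊕ W)
  -- Countably many cofinal conditions put each vertex into the domain or the range; an ideal
  -- meeting them all glues to an isomorphism.
  let D : V ⊕ W → Order.Cofinal {f // IsPartialIso R S f} := Sum.elim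
    (fun a => ⟨{f | ∃ b, (a, b) ∈ f.1}, fun f => by
      obtain ⟨f', hf', hsub, h⟩ := f.2.exists_extend_left hS a
      exact ⟨⟨f', hf'⟩, h, hsub⟩⟩)
    (fun b => ⟨{f | ∃ a, (a, b) ∈ f.1}, fun f => by
      obtain ⟨f', hf', hsub, h⟩ := f.2.exists_extend_right hR b
      exact ⟨⟨f', hf'⟩, h, hsub⟩⟩)
  let I := Order.idealOfCofinals (⟨∅, by simp [IsPartialIso]⟩ : {f // IsPartialIso R S f}) D
  let rel : V → W → Prop := fun a b => ∃ f ∈ I, (a, b) ∈ f.1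
  have hrel : ∀ a b a' b', rel a b → rel a' b' → (a = a' ↔ b = b') ∧ (R.Adj a a' ↔ S.Adj b b') := by
    rintro a b a' b' ⟨f, hf, hab⟩ ⟨f', hf', hab'⟩
    obtain ⟨h, -, h1, h2⟩ := I.directed f hf f' hf'
    exact h.2 _ (h1 hab) _ (h2 hab')
  have hleft : ∀ a, ∃ b, rel a b := fun a => by
    obtain ⟨f, ⟨b, hb⟩, hf⟩ := Order.cofinal_meets_idealOfCofinals _ D (.inl a)
    exact ⟨b, f, hf, hb⟩
  have hright : ∀ b, ∃ a, rel a b := fun b => by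
    obtain ⟨f, ⟨a, ha⟩, hf⟩ := Order.cofinal_meets_idealOfCofinals _ D (.inr b)
    exact ⟨a, f, hf, ha⟩
  choose F hF using hleft
  choose G hG using hright
  exact ⟨{ toFun := F
           invFun := G
           left_inv := fun a => (hrel _ _ _ _ (hG (F a)) (hF a)).1.2 rfl
           right_inv := fun b => (hrel _ _ _ _ (hF (G b)) (hG b)).1.1 rfl
           map_rel_iff' := fun {a a'} => (hrel _ _ _ _ (hF a) (hF a')).2.symm }⟩

end RandomGraph

/-! ### The generic limit and its action. -/

section Generic

variable {Γ X : Type*} [Group Γ] [MulAction Γ X] {T : SimpleGraph X} {x₀ y₀ : X}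

/-- A subgroup `Λ` and a set `P` of double cosets that define on `Γ ⧸ Λ` a random graph on which
`Γ` acts faithfully and homogeneously. -/
structure IsGeneric (Λ : Subgroup Γ) (P : Set Γ) : Prop where
  mul_mem : ∀ σ ∈ P, ∀ g ∈ Λ, ∀ h ∈ Λ, g * σ * h ∈ P
  inv_mem : ∀ σ ∈ P, σ⁻¹ ∈ P
  notMem : ∀ σ ∈ P, σ ∉ Λ
  exists_extension : ∀ U W : Finset Γ, (∀ u ∈ U, ∀ w ∈ W, u⁻¹ * w ∉ Λ) →
    ∃ z : Γ, (∀ u ∈ U, z⁻¹ * u ∈ P) ∧ ∀ w ∈ W, z⁻¹ * w ∉ P ∧ z⁻¹ * w ∉ Λ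
  exists_realize : ∀ S : Finset (Γ × Γ),
    (∀ p ∈ S, ∀ q ∈ S, p ≠ q → p.1⁻¹ * q.1 ∉ Λ ∧ p.2⁻¹ * q.2 ∉ Λ) →
    (∀ p ∈ S, ∀ q ∈ S, p.1⁻¹ * q.1 ∈ P ↔ p.2⁻¹ * q.2 ∈ P) →
    ∃ g : Γ, ∀ p ∈ S, p.2⁻¹ * g * p.1 ∈ Λ
  exists_conj : ∀ g : Γ, g ≠ 1 → ∃ z : Γ, z⁻¹ * g * z ∉ Λ

/-- Each requirement includes its permanent failure as an alternative, which makes it cofinal;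
directedness of the ideal excludes that alternative whenever the hypothesis holds in the limit. -/
theorem IsAdmissible.exists_isGeneric [Countable Γ] (hΓ : IsAdmissible Γ T x₀ y₀) :
    ∃ (Λ : Subgroup Γ) (P : Set Γ), IsGeneric Λ P := by
  let ι := (Finset Γ × Finset Γ) ⊕ Finset (Γ × Γ) ⊕ {g : Γ // g ≠ 1}
  let : Encodable ι := Encodable.ofCountable ι
  let D : ι → Order.Cofinal (Approx Γ T x₀) := Sum.elim
    (fun UW => ⟨{b | (∃ u ∈ UW.1, ∃ w ∈ UW.2, u⁻¹ * w ∈ b.Λ) ∨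
      ∃ z : Γ, (∀ u ∈ UW.1, z⁻¹ * u ∈ b.P) ∧ ∀ w ∈ UW.2, z⁻¹ * w ∈ b.N}, fun a => by
        by_cases h : ∃ u ∈ UW.1, ∃ w ∈ UW.2, u⁻¹ * w ∈ a.Λ
        · exact ⟨a, Or.inl h, le_rfl⟩
        · push Not at h
          obtain ⟨b, hab, hb⟩ := a.exists_extension hΓ UW.1 UW.2 h
          exact ⟨b, Or.inr hb, hab⟩⟩)
    (Sum.elim
      (fun S => ⟨{b | (∃ p ∈ S, ∃ q ∈ S, p ≠ q ∧ (p.1⁻¹ * q.1 ∈ b.Λ ∨ p.2⁻¹ * q.2 ∈ b.Λ)) ∨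
        (∃ p ∈ S, ∃ q ∈ S, (p.1⁻¹ * q.1 ∈ b.P ∧ p.2⁻¹ * q.2 ∈ b.N) ∨
          (p.1⁻¹ * q.1 ∈ b.N ∧ p.2⁻¹ * q.2 ∈ b.P)) ∨
        ∃ g : Γ, ∀ p ∈ S, p.2⁻¹ * g * p.1 ∈ b.Λ}, fun a => by
          obtain ⟨b, hab, hb⟩ := a.exists_realize hΓ S
          exact ⟨b, hb, hab⟩⟩)
      (fun g => ⟨{b | ∃ z : Γ, z⁻¹ * g.1 * z ∈ b.P ∪ b.N}, fun a => by
        obtain ⟨b, hab, hb⟩ := a.exists_conj_notMem hΓ g.2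
        exact ⟨b, hb, hab⟩⟩))
  let I := Order.idealOfCofinals (Approx.trivial Γ T x₀) D
  have hD : ∀ i, ∃ b, b ∈ D i ∧ b ∈ I := Order.cofinal_meets_idealOfCofinals _ D
  have hdir : ∀ a ∈ I, ∀ b ∈ I, ∃ d ∈ I, a ≤ d ∧ b ≤ d := I.directed
  let Λ : Subgroup Γ :=
    { carrier := {g | ∃ b ∈ I, g ∈ b.Λ}
      one_mem' := ⟨_, Order.mem_idealOfCofinals _ D, one_mem _⟩
      mul_mem' := by
        rintro g h ⟨a, ha, hg⟩ ⟨b, hb, hh⟩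
        obtain ⟨d, hd, had, hbd⟩ := hdir a ha b hb
        exact ⟨d, hd, mul_mem (had.1 hg) (hbd.1 hh)⟩
      inv_mem' := by
        rintro g ⟨a, ha, hg⟩
        exact ⟨a, ha, inv_mem hg⟩ }
  have hPN : ∀ a ∈ I, ∀ b ∈ I, ∀ σ ∈ a.P, σ ∉ b.N := by
    intro a ha b hb σ hσ hσ'
    obtain ⟨d, hd, had, hbd⟩ := hdir a ha b hb
    exact d.disj σ (had.2.1 hσ) (hbd.2.2 hσ')
  have hPΛ : ∀ a ∈ I, ∀ σ ∈ a.P, σ ∉ Λ := by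
    rintro a ha σ hσ ⟨b, hb, hσ'⟩
    obtain ⟨d, hd, had, hbd⟩ := hdir a ha b hb
    exact Approx.notMem_P (hbd.1 hσ') (had.2.1 hσ)
  have hNΛ : ∀ a ∈ I, ∀ σ ∈ a.N, σ ∉ Λ := by
    rintro a ha σ hσ ⟨b, hb, hσ'⟩
    obtain ⟨d, hd, had, hbd⟩ := hdir a ha b hb
    exact Approx.notMem_N (hbd.1 hσ') (had.2.2 hσ)
  refine ⟨Λ, {σ | ∃ b ∈ I, σ ∈ b.P}, ⟨?_, ?_, ?_, ?_, ?_, ?_⟩⟩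
  · rintro σ ⟨a, ha, hσ⟩ g ⟨b, hb, hg⟩ h ⟨b', hb', hh⟩
    obtain ⟨d, hd, had, hbd⟩ := hdir a ha b hb
    obtain ⟨d', hd', hdd', hbd'⟩ := hdir d hd b' hb'
    exact ⟨d', hd', d'.mul_P σ (hdd'.2.1 (had.2.1 hσ)) g (hdd'.1 (hbd.1 hg)) h (hbd'.1 hh)⟩
  · rintro σ ⟨a, ha, hσ⟩
    exact ⟨a, ha, a.inv_P σ hσ⟩
  · rintro σ ⟨a, ha, hσ⟩
    exact hPΛ a ha σ hσ
  · intro U W hUW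
    obtain ⟨b, ⟨u, hu, w, hw, h⟩ | ⟨z, hzU, hzW⟩, hb⟩ := hD (.inl (U, W))
    · exact absurd ⟨b, hb, h⟩ (hUW u hu w hw)
    · exact ⟨z, fun u hu => ⟨b, hb, hzU u hu⟩, fun w hw =>
        ⟨fun ⟨a, ha, h⟩ => hPN a ha b hb _ h (hzW w hw), hNΛ b hb _ (hzW w hw)⟩⟩
  · intro S hS hSP
    obtain ⟨b, ⟨p, hp, q, hq, hne, h⟩ | ⟨p, hp, q, hq, h⟩ | ⟨g, hg⟩, hb⟩ := hD (.inr (.inl S))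
    · rcases h with h | h
      · exact absurd ⟨b, hb, h⟩ (hS p hp q hq hne).1
      · exact absurd ⟨b, hb, h⟩ (hS p hp q hq hne).2
    · exfalso
      rcases h with ⟨h, h'⟩ | ⟨h, h'⟩
      · obtain ⟨a, ha, h''⟩ := (hSP p hp q hq).1 ⟨b, hb, h⟩
        exact hPN a ha b hb _ h'' h'
      · obtain ⟨a, ha, h''⟩ := (hSP p hp q hq).2 ⟨b, hb, h'⟩
        exact hPN a ha b hb _ h'' h
    · exact ⟨g, fun p hp => ⟨b, hb, hg p hp⟩⟩
  · intro g hg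
    obtain ⟨b, ⟨z, h | h⟩, hb⟩ := hD (.inr (.inr ⟨g, hg⟩))
    · exact ⟨z, hPΛ b hb _ h⟩
    · exact ⟨z, hNΛ b hb _ h⟩

namespace IsGeneric

variable {Λ : Subgroup Γ} {P : Set Γ}

/-- The graph on `Γ ⧸ Λ` in which `a Λ` and `b Λ` are adjacent if and only if `a⁻¹ b ∈ P`. -/
def graph (h : IsGeneric Λ P) : SimpleGraph (Γ ⧸ Λ) where
  Adj x y := ∃ a b : Γ, (a : Γ ⧸ Λ) = x ∧ (b : Γ ⧸ Λ) = y ∧ a⁻¹ * b ∈ P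
  symm := ⟨by
    rintro x y ⟨a, b, ha, hb, hab⟩
    exact ⟨b, a, hb, ha, by simpa using h.inv_mem _ hab⟩⟩
  loopless := ⟨by
    rintro x ⟨a, b, rfl, hb, hab⟩
    exact h.notMem _ hab (QuotientGroup.eq.1 hb.symm)⟩

theorem graph_adj (h : IsGeneric Λ P) (a b : Γ) :
    h.graph.Adj (a : Γ ⧸ Λ) (b : Γ ⧸ Λ) ↔ a⁻¹ * b ∈ P := by
  refine ⟨?_, fun hab => ⟨a, b, rfl, rfl, hab⟩⟩
  rintro ⟨a', b', ha, hb, hab⟩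
  have := h.mul_mem _ hab _ (QuotientGroup.eq.1 ha.symm) _ (QuotientGroup.eq.1 hb)
  simpa [mul_assoc] using this

theorem graph_adj_smul (h : IsGeneric Λ P) (g : Γ) (x y : Γ ⧸ Λ) :
    h.graph.Adj (g • x) (g • y) ↔ h.graph.Adj x y := by
  induction x using QuotientGroup.induction_on with | H a
  induction y using QuotientGroup.induction_on with | H b
  have h1 : ∀ c : Γ, g • (c : Γ ⧸ Λ) = ((g * c : Γ) : Γ ⧸ Λ) := fun _ => rfl
  rw [h1, h1, graph_adj, graph_adj]
  simp [mul_assoc]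

theorem isRandomGraph [Countable Γ] (h : IsGeneric Λ P) : IsRandomGraph h.graph := by
  classical
  refine ⟨QuotientGroup.mk_surjective.countable, fun U W hUW => ?_⟩
  have hout : ∀ x : Γ ⧸ Λ, ((x.out : Γ) : Γ ⧸ Λ) = x := fun x => QuotientGroup.out_eq' x
  obtain ⟨z, hU, hW⟩ := h.exists_extension (U.image Quotient.out) (W.image Quotient.out) (by
    simp only [Finset.mem_image]
    rintro _ ⟨x, hx, rfl⟩ _ ⟨y, hy, rfl⟩ hxy
    have := QuotientGroup.eq.2 hxy
    rw [hout, hout] at this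
    exact Finset.disjoint_left.1 hUW hx (this ▸ hy))
  have hzU : ∀ x ∈ U, h.graph.Adj (z : Γ ⧸ Λ) x := fun x hx => by
    rw [← hout x, graph_adj]
    exact hU _ (Finset.mem_image_of_mem _ hx)
  refine ⟨(z : Γ ⧸ Λ), fun hz => (hzU _ hz).ne rfl, fun hz => ?_, hzU, fun w hw => ?_⟩
  · refine (hW _ (Finset.mem_image_of_mem _ hz)).2 (QuotientGroup.eq.1 ?_)
    rw [hout]
  · rw [← hout w, graph_adj]
    exact (hW _ (Finset.mem_image_of_mem _ hw)).1

/-- The action of `Γ` by automorphisms on a graph isomorphic to the graph on `Γ ⧸ Λ`. -/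
def action (h : IsGeneric Λ P) {V : Type*} {R : SimpleGraph V} (ψ : h.graph ≃g R) :
    Γ →* (R ≃g R) where
  toFun g := ψ.symm.trans (RelIso.trans
    { toEquiv := MulAction.toPerm g, map_rel_iff' := h.graph_adj_smul g _ _ } ψ)
  map_one' := by
    ext x
    simp [MulAction.toPerm]
  map_mul' g g' := by
    ext x
    simp [MulAction.toPerm, mul_smul]

theorem action_apply (h : IsGeneric Λ P) {V : Type*} {R : SimpleGraph V} (ψ : h.graph ≃g R)
    (g : Γ) (x : V) : h.action ψ g x = ψ (g • ψ.symm x) := rfl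

theorem action_injective (h : IsGeneric Λ P) {V : Type*} {R : SimpleGraph V}
    (ψ : h.graph ≃g R) : Function.Injective (h.action ψ) := by
  rw [injective_iff_map_eq_one]
  intro g hg
  by_contra hne
  obtain ⟨z, hz⟩ := h.exists_conj g hne
  have h1 : h.action ψ g (ψ (z : Γ ⧸ Λ)) = ψ (z : Γ ⧸ Λ) := by rw [hg]; rfl
  rw [action_apply, ψ.symm_apply_apply] at h1
  have h2 : ((z : Γ) : Γ ⧸ Λ) = ((g * z : Γ) : Γ ⧸ Λ) := (ψ.injective h1).symm
  rw [QuotientGroup.eq, ← mul_assoc] at h2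
  exact hz h2

/-- Coset representatives turn the isomorphism into a finite set of pairs in `Γ × Γ`, to which
`exists_realize` applies. -/
theorem isHomogeneousAction (h : IsGeneric Λ P) {V : Type*} {R : SimpleGraph V}
    (ψ : h.graph ≃g R) : IsHomogeneousAction (h.action ψ) := by
  classical
  intro A B hA _ φ
  have := hA.fintype
  let s : V → Γ := fun x => (ψ.symm x).out
  have hs : ∀ x, ((s x : Γ) : Γ ⧸ Λ) = ψ.symm x := fun x => QuotientGroup.out_eq' _
  have hsΛ : ∀ x y, (s x)⁻¹ * s y ∈ Λ ↔ x = y := fun x y => by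
    rw [← QuotientGroup.eq, hs, hs, ψ.symm.injective.eq_iff]
  have hsP : ∀ x y, (s x)⁻¹ * s y ∈ P ↔ R.Adj x y := fun x y => by
    rw [← h.graph_adj, hs, hs, ψ.symm.map_adj_iff]
  obtain ⟨g, hg⟩ := h.exists_realize
    (Finset.univ.image fun x : A => (s (x : V), s (φ x : V))) (by
      simp only [Finset.mem_image, Finset.mem_univ, true_and]
      rintro _ ⟨x, rfl⟩ _ ⟨y, rfl⟩ hne
      simp only [hsΛ, Subtype.coe_inj, φ.injective.eq_iff]
      have : x ≠ y := fun hxy => hne (by rw [hxy])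
      exact ⟨this, this⟩) (by
      simp only [Finset.mem_image, Finset.mem_univ, true_and]
      rintro _ ⟨x, rfl⟩ _ ⟨y, rfl⟩
      simp only [hsP]
      exact (φ.map_adj_iff (v := x) (w := y)).symm)
  refine ⟨g, fun x => ?_⟩
  have h1 := hg _ (Finset.mem_image_of_mem _ (Finset.mem_univ x))
  dsimp only at h1
  rw [mul_assoc, ← QuotientGroup.eq, hs] at h1
  rw [action_apply, ← hs]
  exact (ψ.symm_apply_eq.1 h1).symm

end IsGeneric

end Generic

theorem mainTheorem5 {Γ X V : Type*} [Group Γ] [Countable Γ] [MulAction Γ X] [Nontrivial X]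
    (T : SimpleGraph X) (hT : T.IsTree)
    (hact : ∀ (g : Γ) (x y : X), T.Adj x y → T.Adj (g • x) (g • y))
    (hinv : ∀ (g : Γ) (x y : X), T.Adj x y → ¬ (g • x = y ∧ g • y = x))
    (hvert : ∀ x : X, Infinite (MulAction.stabilizer Γ x))
    (hedge : ∀ x y : X, T.Adj x y →
      Finite (edgeStabilizer Γ x y) ∧
      ((edgeStabilizer Γ x y).subgroupOf (MulAction.stabilizer Γ x)).IsHighlyCoreFree ∧
      ((edgeStabilizer Γ x y).subgroupOf (MulAction.stabilizer Γ y)).IsHighlyCoreFree)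
    (R : SimpleGraph V) (hR : IsRandomGraph R) :
    ∃ π : Γ →* (R ≃g R), Function.Injective π ∧ IsHomogeneousAction π := by
  obtain ⟨x₀⟩ := hT.connected.nonempty
  obtain ⟨y₀, hxy⟩ := hT.connected.preconnected.exists_adj_of_nontrivial x₀
  -- Otherwise the infinite stabilizer of `y₀` would lie in the finite edge stabilizer.
  have hk : ∃ k : Γ, k • y₀ = y₀ ∧ k • x₀ ≠ x₀ := by
    by_contra! hcon
    have := (hedge x₀ y₀ hxy).1
    refine (Set.infinite_coe_iff.1 (hvert y₀)) ((edgeStabilizer Γ x₀ y₀ : Set Γ).toFinite.subset ?_)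
    exact fun k hk => Subgroup.mem_inf.2 ⟨hcon k hk, hk⟩
  have hΓ : IsAdmissible Γ T x₀ y₀ :=
    ⟨hT, hact, fun x y h => (hedge x y h).1, hxy, (hedge x₀ y₀ hxy).2.1, hk⟩
  obtain ⟨Λ, P, h⟩ := hΓ.exists_isGeneric
  obtain ⟨ψ⟩ := h.isRandomGraph.nonempty_iso hR
  exact ⟨h.action ψ, h.action_injective ψ, h.isHomogeneousAction ψ⟩
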